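/- **Theorem 3.1.** Let $\mathcal F$ be the set of all (Borel measurable) functions $f:[0,1]^2\to[0,1]$ such that $f(x,y)$ is non-increasing in $x$ and non-decreasing in $y$, $f(x,1)=1$ for all $x\in[0,1]$, and $f(1,y)=0$ for all $y\in[0,1)$. Let $G=(L,R,E)$ be a finite bipartite graph with offline vertices $v\in L$ of weight $w_v\ge 0$ and online vertices $R$. Given $f\in\mathcal F$, arrival times $\mathbf x\in[0,1]^R$ and ranks $\mathbf y\in[0,1]^L$, the algorithm Ranking processes the online vertices in the order of their arrival times (simultaneous arrivals in a fixed order), and matches each $u\in R$, upon its arrival, to its unmatched neighbor $v$ (if there is one) that maximizes $w_v\,(1-f(x_u,y_v))$; ties are broken in favor of the smaller rank $y_v$, and then by a fixed order of $L$. For $f\in\mathcal F$ let $S_f$ be the set of all pairs of functions $\alpha,\beta:[0,1]\to[0,1]$ with $\beta\le\alpha$ for which there are a finite weighted graph $G$, an edge $(u,v)\in E$, arrival times $\mathbf x_{-u}$ of the online vertices other than $u$ and ranks $\mathbf y_{-v}$ of the offline vertices other than $v$, such that for all $x,y\in[0,1]$, in the run of Ranking with $x_u=x$ and $y_v=y$: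 if $y<\beta(x)$, then $v$ is already matched when $u$ arrives; if $\beta(x)<y<\alpha(x)$, then $u$ is matched to $v$; if $y>\alpha(x)$, then $v$ is unmatched right after $u$'s arrival. Let $S_f^{1}\subseteq S_f$ be the set of the pairs that arise in this way from unweighted graphs ($w\equiv 1$). Put $\beta^{-1}(y)=\sup\{x\in[0,1]:\beta(x)\le y\}$ (with $\sup\emptyset=0$) and $$\Gamma(f,\alpha,\beta)=\int_0^1\alpha(x)\,dx-\int_0^1\beta(x)\,dx+\int_0^1\bigl(1-\alpha(x)+\beta(x)\bigr)\bigl(1-f(x,\alpha(x))\bigr)\,dx+\int_0^1\bigl(1-\beta^{-1}(y)\bigr)f(\beta^{-1}(y),y)\,dy+\int_0^1\!\int_{\alpha(x)}^1 f(\beta^{-1}(y),y)\,dy\,dx .$$ Then $$0.6862\;\le\;\sup_{f\in\mathcal F}\ \inf_{(\alpha,\beta)\in S_f}\Gamma(f,\alpha,\beta)\;\le\;0.7027 ,$$ and the upper bound holds even for unweighted graphs: $$\sup_{f\in\mathcal F}\ \inf_{(\alpha,\beta)\in S_f^{1}}\Gamma(f,\alpha,\beta)\;\le\;0.7027 .$$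 -/

import Mathlib

namespace Ranking

open MeasureTheory Set
open scoped NNReal unitInterval

/-- The class `F` of pricing functions `f : [0,1]² → [0,1]`, the first argument being the arrival
time and the second one the rank. (Measurability is what makes the integrals below meaningful.) -/
structure IsPricing (f : I → I → I) : Prop where
  antitone_time : ∀ y : I, Antitone fun x => f x y
  monotone_rank : ∀ x : I, Monotone (f x)
  rank_one : ∀ x : I, f x 1 = 1
  time_one : ∀ y : I, y < 1 → f 1 y = 0
  measurable : Measurable fun p : I × I => f p.1 p.2

/-- A vertex-weighted bipartite graph with offline vertices `Fin l` and online vertices `Fin r`;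
the offline vertices carry non-negative weights. -/
structure Graph (l r : ℕ) where
  adj : Fin r → Fin l → Prop
  weight : Fin l → ℝ≥0

section Algorithm

variable {l r : ℕ}

/-- Online vertex `u'` arrives strictly before `u` (arrival times `x`; simultaneous arrivals are
ordered by the labels). -/
def Before (x : Fin r → I) (u' u : Fin r) : Prop :=
  x u' < x u ∨ (x u' = x u ∧ u' < u)

/-- The utility `w_v · (1 - f(t, y_v))` that offline vertex `v` offers at time `t`. -/
noncomputable def utility (f : I → I → I) (G : Graph l r) (y : Fin l → I) (t : I) (v : Fin l) : ℝ :=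
  (G.weight v : ℝ) * (1 - (f t (y v) : ℝ))

/-- At time `t`, offline vertex `v` is chosen over `z`: its utility is larger; among equal
utilities the smaller rank wins, among equal ranks the smaller label. On an unweighted graph this
is the order of the ranks, for every `f` that is non-decreasing in the rank. -/
def Prefers (f : I → I → I) (G : Graph l r) (y : Fin l → I) (t : I) (v z : Fin l) : Prop :=
  utility f G y t z < utility f G y t v ∨
    (utility f G y t z = utility f G y t v ∧ (y v < y z ∨ (y v = y z ∧ v < z)))

/-- `v` is a neighbor of `u` that is unmatched when `u` arrives; here `M u' = some z` means that
`u'` is matched to `z`, and `M u' = none` that `u'` stays unmatched. -/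
def Available (G : Graph l r) (x : Fin r → I) (M : Fin r → Option (Fin l)) (u : Fin r)
    (v : Fin l) : Prop :=
  G.adj u v ∧ ∀ u', Before x u' u → M u' ≠ some v

/-- `v` is the most preferred one among the neighbors of `u` that are unmatched when `u` arrives. -/
def IsBest (f : I → I → I) (G : Graph l r) (x : Fin r → I) (y : Fin l → I)
    (M : Fin r → Option (Fin l)) (u : Fin r) (v : Fin l) : Prop :=
  Available G x M u v ∧ ∀ z, Available G x M u z → z ≠ v → Prefers f G y (x u) v z

/-- `M` is the matching produced by Ranking: every online vertex is matched, upon its arrival, to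
its most preferred unmatched neighbor (and stays unmatched if there is no unmatched neighbor). -/
def IsOutcome (f : I → I → I) (G : Graph l r) (x : Fin r → I) (y : Fin l → I)
    (M : Fin r → Option (Fin l)) : Prop :=
  ∀ u v, M u = some v ↔ IsBest f G x y M u v

theorem before_wellFounded (x : Fin r → I) : WellFounded (Before x) := by
  have h : Before x = InvImage (Prod.Lex (· < ·) (· < ·)) (fun u => (x u, u)) := by
    funext a b
    simp [Before, InvImage, Prod.lex_def]
  have : IsTrans (Fin r) (Before x) := ⟨by
    intro a b c hab hbc
    rcases hab with h1 | ⟨h1, h1'⟩ <;> rcases hbc with h2 | ⟨h2, h2'⟩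
    · exact Or.inl (h1.trans h2)
    · exact Or.inl (h2 ▸ h1)
    · exact Or.inl (h1 ▸ h2)
    · exact Or.inr ⟨h1.trans h2, h1'.trans h2'⟩⟩
  have : Std.Irrefl (Before x) := ⟨by
    rintro a (h1 | ⟨_, h1⟩) <;> exact lt_irrefl _ h1⟩
  exact Finite.wellFounded_of_trans_of_irrefl _

theorem Prefers.asymm {f : I → I → I} {G : Graph l r} {y : Fin l → I} {t : I} {v z : Fin l}
    (h : Prefers f G y t v z) : ¬ Prefers f G y t z v := by
  rcases h with h | ⟨h, h' | ⟨h', h''⟩⟩ <;> rintro (k | ⟨k, k' | ⟨k', k''⟩⟩) <;> order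

theorem IsBest.unique {f : I → I → I} {G : Graph l r} {x : Fin r → I} {y : Fin l → I}
    {M : Fin r → Option (Fin l)} {u : Fin r} {v z : Fin l}
    (hv : IsBest f G x y M u v) (hz : IsBest f G x y M u z) : v = z := by
  by_contra hne
  exact (hv.2 z hz.1 (Ne.symm hne)).asymm (hz.2 v hv.1 hne)

theorem isBest_congr {f : I → I → I} {G : Graph l r} {x : Fin r → I} {y : Fin l → I}
    {M M' : Fin r → Option (Fin l)} {u : Fin r} {v : Fin l}
    (h : ∀ u', Before x u' u → M u' = M' u') :
    IsBest f G x y M u v ↔ IsBest f G x y M' u v := by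
  have ha : ∀ z, Available G x M u z ↔ Available G x M' u z := fun z =>
    and_congr_right fun _ => forall₂_congr fun u' hu' => by rw [h u' hu']
  simp only [IsBest, ha]

/-- A run of Ranking has exactly one outcome. -/
theorem existsUnique_isOutcome (f : I → I → I) (G : Graph l r) (x : Fin r → I) (y : Fin l → I) :
    ∃! M, IsOutcome f G x y M := by
  classical
  let wf := before_wellFounded x
  let ext : (u : Fin r) → ((u' : Fin r) → Before x u' u → Option (Fin l)) →
      Fin r → Option (Fin l) :=
    fun u ih u' => if h : Before x u' u then ih u' h else none
  let F : (u : Fin r) → ((u' : Fin r) → Before x u' u → Option (Fin l)) → Option (Fin l) :=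
    fun u ih => if h : ∃ v, IsBest f G x y (ext u ih) u v then some h.choose else none
  let M : Fin r → Option (Fin l) := wf.fix F
  have hM : ∀ u, M u = F u fun u' _ => M u' := fun u => wf.fix_eq F u
  have hb : ∀ u v, IsBest f G x y (ext u fun u' _ => M u') u v ↔ IsBest f G x y M u v :=
    fun u v => isBest_congr fun u' hu' => by simp [ext, hu']
  have h1 : IsOutcome f G x y M := by
    intro u v
    rw [hM u, ← hb u v]
    by_cases h : ∃ v, IsBest f G x y (ext u fun u' _ => M u') u v
    · simp only [F, dif_pos h, Option.some.injEq]
      exact ⟨fun hv => hv ▸ h.choose_spec, fun hv => h.choose_spec.unique hv⟩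
    · simp only [F, dif_neg h]
      exact ⟨fun hv => (nomatch hv), fun hv => (h ⟨v, hv⟩).elim⟩
  refine ⟨M, h1, fun M' hM' => ?_⟩
  funext u
  induction u using wf.induction with
  | _ u ih =>
    refine Option.ext fun v => ?_
    exact (hM' u v).trans ((isBest_congr ih).trans (h1 u v).symm)

/-- The matching that Ranking produces on `G` for arrival times `x` and ranks `y`. -/
noncomputable def outcome (f : I → I → I) (G : Graph l r) (x : Fin r → I) (y : Fin l → I) :
    Fin r → Option (Fin l) :=
  (existsUnique_isOutcome f G x y).choose

theorem isOutcome_outcome (f : I → I → I) (G : Graph l r) (x : Fin r → I) (y : Fin l → I) :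
    IsOutcome f G x y (outcome f G x y) :=
  (existsUnique_isOutcome f G x y).choose_spec.1

/-- The edge `(u,v)` of `G`, together with the arrival times `x` of the vertices other than `u` and
the ranks `y` of the vertices other than `v`, implements the curves `α`, `β`: when `u` arrives at
time `t` and `v` has rank `s`, then `v` is already matched if `s < β t`, the edge `(u,v)` is matched
if `β t < s < α t`, and `v` is unmatched right after `u`'s arrival if `α t < s`.
The values `x u` and `y v` are overwritten and play no role. -/
structure Implements (f : I → I → I) (G : Graph l r) (u : Fin r) (v : Fin l)
    (x : Fin r → I) (y : Fin l → I) (α β : I → I) : Prop where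
  adj : G.adj u v
  le : ∀ t, β t ≤ α t
  matched_before : ∀ t s, s < β t →
    ∃ u', Before (Function.update x u t) u' u ∧
      outcome f G (Function.update x u t) (Function.update y v s) u' = some v
  matched_edge : ∀ t s, β t < s → s < α t →
    outcome f G (Function.update x u t) (Function.update y v s) u = some v
  unmatched_after : ∀ t s, α t < s →
    ∀ u', u' = u ∨ Before (Function.update x u t) u' u →
      outcome f G (Function.update x u t) (Function.update y v s) u' ≠ some v

end Algorithm

/-- The set `S_f` of all pairs of curves `(α, β)` that are implemented by some graph, some edge of
it, and some fixed arrival times and ranks of the other vertices. -/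
def S (f : I → I → I) : Set ((I → I) × (I → I)) :=
  {p | ∃ (l r : ℕ) (G : Graph l r) (u : Fin r) (v : Fin l) (x : Fin r → I) (y : Fin l → I),
    Implements f G u v x y p.1 p.2}

/-- The subset of `S f` that unweighted graphs (all weights equal to `1`) implement. -/
def SUnweighted (f : I → I → I) : Set ((I → I) × (I → I)) :=
  {p | ∃ (l r : ℕ) (G : Graph l r) (u : Fin r) (v : Fin l) (x : Fin r → I) (y : Fin l → I),
    (∀ z, G.weight z = 1) ∧ Implements f G u v x y p.1 p.2}

/-- `β⁻¹(y) = sup {x ∈ [0,1] : β(x) ≤ y}`, which is `0` if there is no such `x`. -/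
noncomputable def inv (β : I → I) (y : I) : I := sSup {x | β x ≤ y}

/-- The functional `Γ(f, α, β)`. All integrals are with respect to Lebesgue measure on `[0,1]`. -/
noncomputable def Gam (f : I → I → I) (α β : I → I) : ℝ :=
  (∫ x : I, (α x : ℝ)) - (∫ x : I, (β x : ℝ))
    + (∫ x : I, (1 - (α x : ℝ) + (β x : ℝ)) * (1 - (f x (α x) : ℝ)))
    + (∫ y : I, (1 - (inv β y : ℝ)) * (f (inv β y) y : ℝ))
    + (∫ x : I, ∫ y in Set.Ioc (α x) 1, (f (inv β y) y : ℝ))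

/-- The value `sup_{f ∈ F} inf_{(α,β) ∈ S_f} Γ(f, α, β)` of the optimization problem. -/
noncomputable def optValue : EReal :=
  ⨆ (f : I → I → I) (_ : IsPricing f), ⨅ p ∈ S f, (Gam f p.1 p.2 : EReal)

/-- The value of the same problem with unweighted graphs only. -/
noncomputable def optValueUnweighted : EReal :=
  ⨆ (f : I → I → I) (_ : IsPricing f), ⨅ p ∈ SUnweighted f, (Gam f p.1 p.2 : EReal)

end Ranking

namespace Ranking

open MeasureTheory Set
open scoped NNReal unitInterval

/-! Lower bound. Decisions made before `u` arrives do not depend on when it arrives, so an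
implemented `β` is monotone (`Implements.monotone`). Besides this, only `β ≤ α` and the
measurability of `α` are used. For these curves `Γ` is the integral of `density` over the unit
square (`Gam_eq_integral_density`), hence the mean, over all shifts of a `12 × 12` grid, of the
average of `density` over the grid points (`integral_prod_eq_sum_cells`). The pricing function
`priceFun` is constant on grid cells, and monotonicity of its table makes every rounding err on the
safe side (`le_sum_density`). For a fixed shift it remains to minimise an explicit integer cost over
integer curves `b ≤ a` with `b` monotone, that is, over a lattice path `b` and heights `a` above it.
A branch and bound search, evaluated by the kernel and proved sound in `branchBound_sound`, gives
the minimum needed (`le_pathCost`).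

Upper bound. The adversary randomises. Unweighted graphs implement all pairs of monotone step
functions `B ≤ A` that jump at common times, provided that `B` starts at `0`
(`step_mem_SUnweighted`). Fifty integer patterns on 8 cells are used, with the jump times and the
levels shifted by independent uniform offsets `θ` and `u`. Read along the rank axis, such step
functions are again of the same type, so that the horizontal and vertical parts of `Γ` have one
common form (`Gam_step`). Averaging over the offsets turns `Γ` into a linear form in finitely many
weighted means of `f` over cells (`integral_Gam_step`), and these means inherit the monotonicity and
the boundary values of `f`. A weighted sum of the fifty forms is then bounded for all monotone
tables by linear programming duality, with the multipliers `rankFlow` and `timeFlow` (`sum_flow_le`,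
`sum_totalGain_sub_le`). The weighted average of `Γ` comes out below `0.7026`, so some pair of
curves has `Γ` at most `0.7027`. -/

/-! ### Step curves implemented by unweighted graphs -/

/-- A downward closed set of indices is an initial segment, and its cardinality is its endpoint.
This is how `jumps`, `sampleCurve` and `countUpTo` are inverted. -/
theorem lt_card_filter_range_iff {P : ℕ → Prop} [DecidablePred P] {N : ℕ}
    (hP : ∀ i j, i ≤ j → j < N → P j → P i) {e : ℕ} (he : e < N) :
    e < ((Finset.range N).filter P).card ↔ P e := by
  constructor
  · intro h
    by_contra hn
    have : (Finset.range N).filter P ⊆ Finset.range e := by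
      intro j hj
      rw [Finset.mem_filter, Finset.mem_range] at hj
      rw [Finset.mem_range]
      by_contra hje
      exact hn (hP e j (not_lt.1 hje) hj.1 hj.2)
    have := Finset.card_le_card this
    rw [Finset.card_range] at this
    omega
  · intro h
    have : Finset.range (e + 1) ⊆ (Finset.range N).filter P := by
      intro j hj
      rw [Finset.mem_range] at hj
      rw [Finset.mem_filter, Finset.mem_range]
      exact ⟨by omega, hP j e (by omega) he h⟩
    have := Finset.card_le_card this
    rw [Finset.card_range] at this
    omega

theorem card_filter_range_le (P : ℕ → Prop) [DecidablePred P] (N : ℕ) :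
    ((Finset.range N).filter P).card ≤ N :=
  (Finset.card_filter_le _ _).trans (Finset.card_range N).le

/-- The number of jump times among `τ 0, …, τ (N - 1)` up to time `t`. -/
noncomputable def jumps (τ : ℕ → I) (N : ℕ) (t : I) : ℕ :=
  ((Finset.range N).filter fun e => τ e ≤ t).card

theorem jumps_le (τ : ℕ → I) (N : ℕ) (t : I) : jumps τ N t ≤ N := card_filter_range_le _ _

theorem lt_jumps_iff {τ : ℕ → I} (hτ : Monotone τ) {N : ℕ} {t : I} {e : ℕ} (he : e < N) :
    e < jumps τ N t ↔ τ e ≤ t :=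
  lt_card_filter_range_iff (fun _ _ hij _ hj => (hτ hij).trans hj) he

theorem Before.trans {r : ℕ} {x : Fin r → I} {a b c : Fin r} (h : Before x a b)
    (h' : Before x b c) : Before x a c := by
  rcases h with h1 | ⟨h1, h1'⟩ <;> rcases h' with h2 | ⟨h2, h2'⟩
  · exact Or.inl (h1.trans h2)
  · exact Or.inl (h2 ▸ h1)
  · exact Or.inl (h1 ▸ h2)
  · exact Or.inr ⟨h1.trans h2, h1'.trans h2'⟩

theorem Before.irrefl {r : ℕ} {x : Fin r → I} (a : Fin r) : ¬ Before x a a := by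
  rintro (h1 | ⟨_, h1⟩) <;> exact lt_irrefl _ h1

theorem Before.asymm {r : ℕ} {x : Fin r → I} {a b : Fin r} (h : Before x a b) :
    ¬ Before x b a := fun h' => Before.irrefl a (h.trans h')

/-- In an unweighted graph the smaller rank is preferred. -/
theorem prefers_of_rank_lt {f : I → I → I} (hf : ∀ x, Monotone (f x)) {l r : ℕ} {G : Graph l r}
    (hG : ∀ z, G.weight z = 1) {y : Fin l → I} {t : I} {v z : Fin l} (h : y v < y z) :
    Prefers f G y t v z := by
  have h1 : (f t (y v) : ℝ) ≤ f t (y z) := hf t h.le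
  unfold Prefers utility
  rw [hG, hG]
  simp only [NNReal.coe_one, one_mul]
  rcases h1.lt_or_eq with h2 | h2
  · exact Or.inl (by linarith)
  · exact Or.inr ⟨by rw [h2], Or.inl h⟩

/-- Online vertices: `e < N` only sees the offline vertex `e`; `N ≤ e < 2N` sees `e + 1` and the
special vertex `2N + 1`; `2N` is the special vertex, which sees `0, …, N` and `2N + 1`. -/
def stepGraph (N : ℕ) : Graph (2 * N + 2) (2 * N + 1) where
  adj e z := (e.1 < N ∧ z.1 = e.1) ∨
    (N ≤ e.1 ∧ e.1 < 2 * N ∧ (z.1 = e.1 + 1 ∨ z.1 = 2 * N + 1)) ∨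
    (e.1 = 2 * N ∧ (z.1 ≤ N ∨ z.1 = 2 * N + 1))
  weight _ := 1

/-- Give the offline vertices `0, …, N` the ranks `A 0, …, A N`, and the private vertex of the
`k`-th blocker the rank `B (k + 1)`. Both the `k`-th remover and the `k`-th blocker arrive at `τ k`.
After `c` jumps the best alternative left to `u` has rank `A c`, and `v` has been taken by a blocker
when its rank is below `B c`, but not when it is above. The vertex `u` carries the largest label, so
arrivals at exactly time `t` precede it, in agreement with `τ e ≤ t` in `jumps`. Before the first
jump there is no blocker, whence `B 0 = 0`. -/
theorem step_mem_SUnweighted {f : I → I → I} (hf : ∀ x, Monotone (f x)) (N : ℕ)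
    {τ A B : ℕ → I} (hτ : Monotone τ) (hA : Monotone A) (hB : Monotone B) (hB0 : B 0 = 0)
    (hBA : ∀ p, B p ≤ A p) :
    ((fun t => A (jumps τ N t)), (fun t => B (jumps τ N t))) ∈ SUnweighted f := by
  classical
  let u : Fin (2 * N + 1) := ⟨2 * N, by omega⟩
  let v : Fin (2 * N + 2) := ⟨2 * N + 1, by omega⟩
  let x : Fin (2 * N + 1) → I := fun e => if e.1 < N then τ e.1 else τ (e.1 - N)
  let y : Fin (2 * N + 2) → I := fun z => if z.1 ≤ N then A z.1 else B (z.1 - N)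
  have hW : ∀ z, (stepGraph N).weight z = 1 := fun _ => rfl
  -- who arrives before the special vertex
  have hbef : ∀ (t : I) (e : Fin (2 * N + 1)), Before (Function.update x u t) e u ↔
      e ≠ u ∧ x e ≤ t := by
    intro t e
    unfold Before
    by_cases he : e = u
    · simp [he]
    · have : e < u := lt_of_le_of_ne (Fin.le_def.2 (by have := e.2; show e.1 ≤ 2 * N; omega)) he
      simp [he, this, le_iff_lt_or_eq]
  have hY : ∀ (s : I) (z : Fin (2 * N + 2)), z ≠ v → Function.update y v s z = y z :=
    fun s z hz => Function.update_of_ne hz _ _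
  have hYv : ∀ s : I, Function.update y v s v = s := fun s => Function.update_self _ _ _
  refine ⟨2 * N + 2, 2 * N + 1, stepGraph N, u, v, x, y, hW, ?_⟩
  -- general facts on the outcome
  have hadj : ∀ t s e z, outcome f (stepGraph N) (Function.update x u t) (Function.update y v s) e
      = some z → (stepGraph N).adj e z := fun t s e z h =>
    ((isOutcome_outcome _ _ _ _ _ _).1 h).1.1
  have huniq : ∀ t s e z, outcome f (stepGraph N) (Function.update x u t) (Function.update y v s) u
      = some z → outcome f (stepGraph N) (Function.update x u t) (Function.update y v s) e
      = some z → ¬ Before (Function.update x u t) e u := fun t s e z h h' hb =>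
    ((isOutcome_outcome _ _ _ _ _ _).1 h).1.2 e hb h'
  -- the private alternative of a blocker is available to it
  have hprivate : ∀ t s (e : Fin (2 * N + 1)) (z : Fin (2 * N + 2)), N ≤ e.1 → e.1 < 2 * N →
      z.1 = e.1 + 1 → Available (stepGraph N) (Function.update x u t)
        (outcome f (stepGraph N) (Function.update x u t) (Function.update y v s)) e z := by
    intro t s e z h1 h2 hz
    refine ⟨Or.inr (Or.inl ⟨h1, h2, Or.inl hz⟩), fun e' hb h => ?_⟩
    have := hadj _ _ _ _ h
    have hee : e' = e := by
      rcases this with ⟨h3, h4⟩ | ⟨h3, h4, h5 | h5⟩ | ⟨h3, h4 | h4⟩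
      · omega
      · exact Fin.ext (by omega)
      · omega
      · omega
      · omega
    exact Before.irrefl _ (hee ▸ hb)
  -- before the special vertex arrives, the vertex `v` survives if its rank is large
  have hsurv : ∀ t s, B (jumps τ N t) < s → ∀ e, Before (Function.update x u t) e u →
      outcome f (stepGraph N) (Function.update x u t) (Function.update y v s) e ≠ some v := by
    intro t s hs e hb h
    have hb' := (hbef t e).1 hb
    have hne : e.1 ≠ 2 * N := fun h => hb'.1 (Fin.ext h)
    rcases hadj _ _ _ _ h with ⟨h1, h2⟩ | ⟨h1, h2, _⟩ | ⟨h1, _⟩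
    · have : v.1 = 2 * N + 1 := rfl
      omega
    · let z : Fin (2 * N + 2) := ⟨e.1 + 1, by omega⟩
      have hzv : z ≠ v := fun h => by have := congrArg Fin.val h; simp only [z, v] at this; omega
      have hp := ((isOutcome_outcome _ _ _ _ _ _).1 h).2 z (hprivate t s e z h1 h2 rfl) hzv
      have hxe : x e = τ (e.1 - N) := if_neg (by omega)
      have hlt : e.1 - N < jumps τ N t := (lt_jumps_iff hτ (by omega)).2 (hxe ▸ hb'.2)
      have hyz : y z = B (e.1 + 1 - N) := if_neg (by simp only [z]; omega)
      -- A blocker that has arrived prefers its private vertex, whose rank is at most `B c < s`.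
      refine hp.asymm (prefers_of_rank_lt hf hW ?_)
      rw [hY _ _ hzv, hYv, hyz]
      exact (hB (by omega)).trans_lt hs
    · exact hne h1
  -- alternatives of the special vertex
  have hz : ∀ t s (z : Fin (2 * N + 2)), z.1 ≤ N →
      (Available (stepGraph N) (Function.update x u t)
        (outcome f (stepGraph N) (Function.update x u t) (Function.update y v s)) u z ↔
      jumps τ N t ≤ z.1) := by
    intro t s z hzN
    have hon : ∀ e', outcome f (stepGraph N) (Function.update x u t) (Function.update y v s) e'
        = some z → e' ≠ u → e'.1 = z.1 ∧ e'.1 < N := by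
      intro e' h hne
      have hne' : e'.1 ≠ 2 * N := fun h => hne (Fin.ext h)
      rcases hadj _ _ _ _ h with ⟨h3, h4⟩ | ⟨h3, h4, h5 | h5⟩ | ⟨h3, _⟩
      · exact ⟨h4.symm, h3⟩
      · omega
      · omega
      · exact absurd h3 hne'
    constructor
    · intro h
      by_contra hlt
      have hj := jumps_le τ N t
      let e : Fin (2 * N + 1) := ⟨z.1, by omega⟩
      have hxe : x e = τ z.1 := if_pos (by simp only [e]; omega)
      have hb : Before (Function.update x u t) e u := (hbef t e).2
        ⟨fun h => by have := congrArg Fin.val h; simp only [e, u] at this; omega,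
          hxe ▸ (lt_jumps_iff hτ (e := z.1) (N := N) (by omega)).1 (by omega)⟩
      refine h.2 e hb ((isOutcome_outcome _ _ _ _ _ _).2 ⟨⟨Or.inl ⟨by simp only [e]; omega, rfl⟩,
        fun e' hb' h' => ?_⟩, fun z' h' hne => ?_⟩)
      · have he' : e' ≠ u := fun hh => (hh ▸ hb').asymm hb
        have : e' = e := Fin.ext (hon e' h' he').1
        exact Before.irrefl _ (this ▸ hb')
      · rcases h'.1 with ⟨_, h4⟩ | ⟨h3, _⟩ | ⟨h3, _⟩
        · exact absurd (Fin.ext h4) hne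
        · simp only [e] at h3; omega
        · simp only [e] at h3; omega
    · intro h
      refine ⟨Or.inr (Or.inr ⟨rfl, Or.inl hzN⟩), fun e' hb h' => ?_⟩
      have hb' := (hbef t e').1 hb
      have := hon e' h' hb'.1
      have hxe : x e' = τ e'.1 := if_pos this.2
      have := (lt_jumps_iff hτ this.2).2 (hxe ▸ hb'.2)
      omega
  refine ⟨Or.inr (Or.inr ⟨rfl, Or.inr rfl⟩), fun t => hBA _, fun t s hs => ?_, fun t s hs1 hs2 => ?_,
    fun t s hs e he => ?_⟩
  · -- the last blocker takes `v` unless somebody else has done so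
    set c := jumps τ N t with hc
    have hcN := jumps_le τ N t
    have hc0 : c ≠ 0 := fun h => by
      have h1 : s < B c := hs
      rw [h, hB0] at h1
      exact absurd h1 (not_lt.2 s.2.1)
    let e : Fin (2 * N + 1) := ⟨N + (c - 1), by omega⟩
    have hxe : x e = τ (c - 1) := by
      simp only [x, e, if_neg (show ¬ N + (c - 1) < N by omega), Nat.add_sub_cancel_left]
    have hb : Before (Function.update x u t) e u := (hbef t e).2
      ⟨fun h => by have := congrArg Fin.val h; simp only [e, u] at this; omega,
        hxe ▸ (lt_jumps_iff hτ (e := c - 1) (N := N) (by omega)).1 (by omega)⟩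
    by_cases hex : ∃ e', Before (Function.update x u t) e' e ∧
        outcome f (stepGraph N) (Function.update x u t) (Function.update y v s) e' = some v
    · obtain ⟨e', h1, h2⟩ := hex
      exact ⟨e', h1.trans hb, h2⟩
    · push Not at hex
      refine ⟨e, hb, (isOutcome_outcome _ _ _ _ _ _).2 ⟨⟨Or.inr (Or.inl ⟨by simp only [e]; omega,
        by simp only [e]; omega, Or.inr rfl⟩), hex⟩, fun z h' hne => prefers_of_rank_lt hf hW ?_⟩⟩
      rcases h'.1 with ⟨h3, _⟩ | ⟨_, _, h5 | h5⟩ | ⟨h3, _⟩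
      · simp only [e] at h3; omega
      · have hyz : y z = B c := by
          simp only [e] at h5
          simp only [y, if_neg (show ¬ z.1 ≤ N by omega)]
          congr 1
          omega
        rw [hY _ _ hne, hYv, hyz]
        exact hs
      · exact absurd (Fin.ext h5) hne
      · simp only [e] at h3; omega
  · refine (isOutcome_outcome _ _ _ _ _ _).2 ⟨⟨Or.inr (Or.inr ⟨rfl, Or.inr rfl⟩),
      hsurv t s hs1⟩, fun z h' hne => prefers_of_rank_lt hf hW ?_⟩
    have hzN : z.1 ≤ N := by
      rcases h'.1 with ⟨h3, _⟩ | ⟨_, h3, _⟩ | ⟨_, h5 | h5⟩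
      · simp only [u] at h3; omega
      · simp only [u] at h3; omega
      · exact h5
      · exact absurd (Fin.ext h5) hne
    have hyz : y z = A z.1 := if_pos hzN
    rw [hY _ _ hne, hYv, hyz]
    exact hs2.trans_le (hA ((hz t s z hzN).1 h'))
  · rcases he with rfl | hb
    · intro h
      have hcN := jumps_le τ N t
      -- The first alternative not yet removed; one is left even after all `N` jumps, since there
      -- are `N + 1` of them.
      let z : Fin (2 * N + 2) := ⟨jumps τ N t, by omega⟩
      have hzv : z ≠ v := fun h => by have := congrArg Fin.val h; simp only [z, v] at this; omega
      have hp := ((isOutcome_outcome _ _ _ _ _ _).1 h).2 z ((hz t s z hcN).2 le_rfl) hzv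
      have hyz : y z = A (jumps τ N t) := if_pos hcN
      refine hp.asymm (prefers_of_rank_lt hf hW ?_)
      rw [hY _ _ hzv, hYv, hyz]
      exact hs
    · exact hsurv t s ((hBA _).trans_lt hs) e hb

/-! ### The price table and its branch and bound certificate -/

/-- The table of the pricing function of the lower bound, in units of `1 / 10000`: row `i` belongs
to the arrival times in `[i / 12, (i + 1) / 12)`, column `k` to the ranks in
`[k / 12, (k + 1) / 12)`; the last row and the last column belong to the value `1`. -/
def priceTable : List (List ℕ) :=
  [[4995, 5366, 5686, 6003, 6301, 6635, 6969, 7293, 7659, 8054, 8495, 8956, 10000],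
   [4638, 4995, 5322, 5650, 5965, 6329, 6693, 7047, 7445, 7878, 8263, 8956, 10000],
   [4314, 4668, 5025, 5319, 5665, 5987, 6363, 6731, 7211, 7485, 8166, 8956, 10000],
   [3992, 4355, 4691, 5003, 5310, 5657, 5978, 6313, 6887, 7477, 8039, 8840, 10000],
   [3702, 4038, 4343, 4693, 4968, 5278, 5792, 6046, 6596, 7173, 7817, 8750, 10000],
   [3367, 3673, 4021, 4347, 4654, 5008, 5346, 5832, 6282, 6819, 7568, 8750, 10000],
   [3037, 3313, 3644, 4024, 4280, 4632, 5025, 5456, 5877, 6409, 7568, 8750, 10000],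
   [2718, 2965, 3261, 3624, 3962, 4144, 4521, 5142, 5877, 5896, 7568, 8000, 10000],
   [2361, 2576, 2834, 3129, 3413, 3735, 4066, 4066, 4645, 5896, 6070, 8000, 10000],
   [1982, 2162, 2379, 2546, 2799, 3149, 3587, 4004, 4004, 4620, 6070, 8000, 10000],
   [1574, 1717, 1888, 1977, 1977, 2504, 2504, 3338, 4004, 4620, 4620, 5505, 10000],
   [909, 992, 1091, 1212, 1212, 1212, 1818, 2000, 2000, 2000, 4620, 4620, 10000],
   [0, 0, 0, 0, 0, 0, 0, 0, 0, 0, 0, 0, 10000]]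

def priceRow (i : ℕ) : List ℕ := priceTable.getD i []

def price (i k : ℕ) : ℕ := (priceRow i).getD k 0

section BranchAndBound

/-! The functions of this section are evaluated by the kernel, which is why they are written with
recursors and with the operations on natural numbers that the kernel knows. -/

noncomputable def natMin (a b : ℕ) : ℕ := Nat.sub a (Nat.sub a b)

/-- Given `t = [t_h, …, t_N]` and `s = [s_h, …, s_N]`, the minimum of
`120000 + s_k - t_k * (c - (k - h))`. -/
noncomputable def minCost (t : List ℕ) : List ℕ → ℕ → ℕ :=
  List.rec (motive := fun _ => List ℕ → ℕ → ℕ) (fun _ _ => 10000000)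
    (fun t _ ih s c => List.rec (motive := fun _ => ℕ) 10000000 (fun a s _ =>
      natMin (Nat.sub (Nat.add 120000 a) (Nat.mul t c)) (ih s (Nat.pred c))) s) t

/-- Entry `h` is the cheapest cost of a column in which `β` has height `h`, minimised over the
height of `α`. -/
noncomputable def minCosts (t : List ℕ) : List ℕ → List ℕ :=
  List.rec (motive := fun _ => List ℕ → List ℕ) (fun _ => [])
    (fun t ts ih s => List.rec (motive := fun _ => List ℕ) [] (fun a s _ =>
      minCost (t :: ts) (a :: s) 12 :: ih s) s) t

/-- Extends `s` to the left by the sums of its head and the final segments of `t`. -/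
noncomputable def extendSums (t s : List ℕ) : List ℕ :=
  List.rec (motive := fun _ => List ℕ) s (fun t _ ih => Nat.add t (ih.headD 0) :: ih) t

/-- One sweep of the dynamic program in the direction of the rank: `a` is the value just computed,
`e` holds the values of the previous column, `m` and `v` the costs of horizontal and vertical steps.
-/
noncomputable def scanMin (e : List ℕ) : ℕ → List ℕ → List ℕ → List ℕ :=
  List.rec (motive := fun _ => ℕ → List ℕ → List ℕ → List ℕ) (fun _ _ _ => [])
    (fun e _ ih a m v => List.rec (motive := fun _ => List ℕ) [] (fun m ms _ =>
      List.rec (motive := fun _ => List ℕ) [] (fun v vs _ =>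
        natMin (Nat.add e m) (Nat.add a v) :: ih (natMin (Nat.add e m) (Nat.add a v)) ms vs)
        v) m) e

noncomputable def nextCosts (e m v : List ℕ) : List ℕ :=
  List.rec (motive := fun _ => List ℕ) [] (fun e es _ =>
    List.rec (motive := fun _ => List ℕ) [] (fun m ms _ =>
      Nat.add e m :: scanMin es (Nat.add e m) ms v) m) e

noncomputable def stepCosts (x y : ℕ) : List ℕ :=
  List.rec (motive := fun _ => List ℕ) [] (fun t _ ih => Nat.mul t (Nat.sub 12 x) :: ih)
    (List.take y (priceRow x))

noncomputable def partialSums (v : List ℕ) : ℕ → List ℕ :=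
  List.rec (motive := fun _ => ℕ → List ℕ) (fun a => [a])
    (fun v _ ih a => a :: ih (Nat.add a v)) v

/-- A relaxation: the tail sums `s` are frozen instead of following the path, which makes the costs
of the steps independent of each other and a dynamic program possible. -/
noncomputable def pathCosts (s : List ℕ) (y x : ℕ) : List ℕ :=
  Nat.rec (motive := fun _ => List ℕ) (partialSums (stepCosts 0 y) 0)
    (fun x ih => nextCosts ih (minCosts (priceRow x) s) (stepCosts (Nat.succ x) y)) x

/-- A lower bound for the cost of a path from `(0, 0)` to `(x, y)`. -/
noncomputable def remainingCost (x y : ℕ) (s : List ℕ) : ℕ :=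
  List.getD (pathCosts (extendSums (List.take y (priceRow x)) s) y x) y 0

/-- Branch and bound along a lattice path that is followed backwards from `(12, 12)`. -/
noncomputable def branchBound (C n : ℕ) : ℕ → ℕ → ℕ → List ℕ → Bool :=
  Nat.rec (motive := fun _ => ℕ → ℕ → ℕ → List ℕ → Bool) (fun _ _ _ _ => false)
    (fun _ ih x y acc s => or (Nat.ble C (Nat.add acc (remainingCost x y s)))
      (and (Nat.ble 1 (Nat.add x y)) (and (or (Nat.beq y 0) (ih x (Nat.pred y)
          (Nat.add acc (Nat.mul (List.getD (priceRow x) (Nat.pred y) 0) (Nat.sub 12 x)))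
          (Nat.add (List.getD (priceRow x) (Nat.pred y) 0) (s.headD 0) :: s)))
        (or (Nat.beq x 0) (ih (Nat.pred x) y
          (Nat.add acc (minCost (List.drop y (priceRow (Nat.pred x))) s 12)) s))))) n

/-- Here `988128 = 0.6862 * 12 ^ 2 * 10000`. Depth 25 accounts for the 24 steps of a path and the
evaluation at its last point. -/
theorem branchBound_eq_true : branchBound 988128 25 12 12 0 [0] = true := by
  decide +kernel

end BranchAndBound

/-! ### What the list functions compute -/

theorem natMin_eq (a b : ℕ) : natMin a b = min a b := by
  show a - (a - b) = _
  omega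

theorem minCost_cons (t a : ℕ) (ts s : List ℕ) (c : ℕ) :
    minCost (t :: ts) (a :: s) c = min (120000 + a - t * c) (minCost ts s (c - 1)) :=
  natMin_eq _ _

theorem minCost_le (t : List ℕ) : ∀ (s : List ℕ) (c n : ℕ), n < t.length → n < s.length →
    minCost t s c ≤ 120000 + s.getD n 0 - t.getD n 0 * (c - n) := by
  induction t with
  | nil => intro s c n h; simp at h
  | cons t ts ih =>
    intro s c n h1 h2
    cases s with
    | nil => simp at h2
    | cons a s =>
      rw [minCost_cons]
      cases n with
      | zero => simp
      | succ n =>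
        have := ih s (c - 1) n (by simpa using h1) (by simpa using h2)
        rw [List.getD_cons_succ, List.getD_cons_succ, show c - (n + 1) = c - 1 - n by omega]
        exact (min_le_right _ _).trans this

theorem length_minCosts (t : List ℕ) : ∀ s : List ℕ, (minCosts t s).length = min t.length s.length := by
  induction t with
  | nil => intro s; simp [minCosts]
  | cons t ts ih =>
    intro s
    cases s with
    | nil => simp [minCosts]
    | cons a s =>
      show (minCosts ts s).length + 1 = _
      rw [ih, List.length_cons, List.length_cons, Nat.succ_min_succ]

theorem getD_minCosts (t : List ℕ) : ∀ (s : List ℕ) (n : ℕ), n < t.length → n < s.length →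
    (minCosts t s).getD n 0 = minCost (t.drop n) (s.drop n) 12 := by
  induction t with
  | nil => intro s n h; simp at h
  | cons t ts ih =>
    intro s n h1 h2
    cases s with
    | nil => simp at h2
    | cons a s =>
      cases n with
      | zero => rfl
      | succ n => exact ih s n (by simpa using h1) (by simpa using h2)

theorem length_extendSums (t s : List ℕ) : (extendSums t s).length = t.length + s.length := by
  induction t with
  | nil => simp [extendSums]
  | cons t ts ih =>
    show (extendSums ts s).length + 1 = _
    rw [ih, List.length_cons]
    omega

/-- Lower bounds for the increments `F` and for the later tails add up to lower bounds for the
earlier tails. -/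
theorem getD_extendSums_le {F S : ℕ → ℕ} (s : List ℕ) (hs : s ≠ []) (t : List ℕ) :
    ∀ m, (∀ k, m ≤ k → k < m + t.length → S k = F k + S (k + 1)) →
      (∀ n, n < t.length → t.getD n 0 ≤ F (m + n)) →
      (∀ n, n < s.length → s.getD n 0 ≤ S (m + t.length + n)) →
      ∀ n, n < t.length + s.length → (extendSums t s).getD n 0 ≤ S (m + n) := by
  induction t with
  | nil =>
    intro m _ _ h n hn
    have := h n (by simpa using hn)
    rwa [List.length_nil, Nat.add_zero] at this
  | cons t ts ih =>
    intro m hS ht h n hn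
    have key := ih (m + 1) (fun k h1 h2 => hS k (by omega) (by rw [List.length_cons]; omega))
      (fun n hn => by
        have := ht (n + 1) (by rw [List.length_cons]; omega)
        rwa [List.getD_cons_succ, show m + (n + 1) = m + 1 + n by omega] at this)
      (fun n hn => by
        have := h n hn
        rwa [List.length_cons, show m + (ts.length + 1) + n = m + 1 + ts.length + n by omega]
          at this)
    show ((t + (extendSums ts s).headD 0) :: extendSums ts s).getD n 0 ≤ _
    cases n with
    | zero =>
      have h1 := key 0 (by have := List.length_pos_of_ne_nil hs; omega)
      have h2 := ht 0 (by simp)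
      have h3 := hS m le_rfl (by simp)
      rw [List.getD_cons_zero] at h2 ⊢
      rw [List.headD_eq_head?_getD, List.head?_eq_getElem?]
      rw [List.getD_eq_getElem?_getD] at h1
      simp only [Nat.add_zero] at *
      omega
    | succ n =>
      rw [List.getD_cons_succ, show m + (n + 1) = m + 1 + n by omega]
      exact key n (by rw [List.length_cons] at hn; omega)

theorem length_scanMin (e : List ℕ) : ∀ (a : ℕ) (m v : List ℕ), e.length ≤ m.length →
    e.length ≤ v.length → (scanMin e a m v).length = e.length := by
  induction e with
  | nil => intro a m v _ _; rfl
  | cons e es ih =>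
    intro a m v hm hv
    cases m with
    | nil => simp at hm
    | cons m ms =>
      cases v with
      | nil => simp at hv
      | cons v vs =>
        show (scanMin es _ ms vs).length + 1 = _
        rw [ih _ _ _ (by simpa using hm) (by simpa using hv), List.length_cons]

/-- The scan minimises over two predecessors, whereas the one path with cost `g` has a single
predecessor at each point. The predicate `P` marks the points of that path; nothing is claimed
elsewhere. -/
theorem getD_scanMin_le {P : ℕ → Prop} {g : ℕ → ℕ} (e : List ℕ) :
    ∀ (k a : ℕ) (m v : List ℕ), e.length ≤ m.length → e.length ≤ v.length → (P k → a ≤ g k) →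
      (∀ n, n < e.length → P (k + n + 1) →
        (P (k + n) ∧ g (k + n) + v.getD n 0 ≤ g (k + n + 1)) ∨
          e.getD n 0 + m.getD n 0 ≤ g (k + n + 1)) →
      ∀ n, n < e.length → P (k + n + 1) → (scanMin e a m v).getD n 0 ≤ g (k + n + 1) := by
  induction e with
  | nil => intro k a m v _ _ _ _ n h; simp at h
  | cons e es ih =>
    intro k a m v hm hv ha h n hn hP
    cases m with
    | nil => simp at hm
    | cons m ms =>
      cases v with
      | nil => simp at hv
      | cons v vs =>
        have h0 : P (k + 1) → min (e + m) (a + v) ≤ g (k + 1) := by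
          intro hP
          rcases h 0 (by simp) (by simpa using hP) with ⟨h1, h2⟩ | h1
          · have := ha (by simpa using h1)
            simp only [Nat.add_zero, List.getD_cons_zero] at h2
            omega
          · simp only [Nat.add_zero, List.getD_cons_zero] at h1
            omega
        have hE : scanMin (e :: es) a (m :: ms) (v :: vs) = min (e + m) (a + v) ::
            scanMin es (min (e + m) (a + v)) ms vs := by
          rw [← natMin_eq]; rfl
        rw [hE]
        cases n with
        | zero => simpa using h0 (by simpa using hP)
        | succ n =>
          have := ih (k + 1) (min (e + m) (a + v)) ms vs (by simpa using hm) (by simpa using hv)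
            h0 (fun n hn hP => by
              have := h (n + 1) (by simpa using hn)
              simp only [List.getD_cons_succ] at this
              rw [show k + (n + 1) = k + 1 + n by omega] at this
              exact this hP) n (by simpa using hn)
          rw [List.getD_cons_succ, show k + (n + 1) = k + 1 + n by omega]
          exact this (by rwa [show k + 1 + n = k + (n + 1) by omega])

theorem length_nextCosts (e m v : List ℕ) (hm : e.length ≤ m.length)
    (hv : e.length ≤ v.length + 1) : (nextCosts e m v).length = e.length := by
  cases e with
  | nil => rfl
  | cons e es =>
    cases m with
    | nil => simp at hm
    | cons m ms =>
      show (scanMin es _ ms v).length + 1 = _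
      rw [length_scanMin _ _ _ _ (by simpa using hm) (by simpa using hv), List.length_cons]

theorem getD_nextCosts_le {P : ℕ → Prop} {g : ℕ → ℕ} (e m v : List ℕ) (hm : e.length ≤ m.length)
    (hv : e.length ≤ v.length + 1) (h0 : P 0 → e.getD 0 0 + m.getD 0 0 ≤ g 0)
    (h : ∀ n, n + 1 < e.length → P (n + 1) → (P n ∧ g n + v.getD n 0 ≤ g (n + 1)) ∨
      e.getD (n + 1) 0 + m.getD (n + 1) 0 ≤ g (n + 1)) (n : ℕ) (hn : n < e.length) (hP : P n) :
    (nextCosts e m v).getD n 0 ≤ g n := by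
  cases e with
  | nil => simp at hn
  | cons e es =>
    cases m with
    | nil => simp at hm
    | cons m ms =>
      show ((e + m) :: scanMin es (e + m) ms v).getD n 0 ≤ g n
      cases n with
      | zero => simpa using h0 hP
      | succ n =>
        have := getD_scanMin_le (P := P) (g := g) es 0 (e + m) ms v (by simpa using hm)
          (by simpa using hv) (fun hP => by simpa using h0 hP) (fun n hn hP => by
            have := h n (by simpa using hn) (by simpa using hP)
            simpa using this) n (by simpa using hn) (by simpa using hP)
        simpa using this

theorem length_stepCosts {x y : ℕ} (h : y ≤ (priceRow x).length) : (stepCosts x y).length = y := by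
  have : ∀ l : List ℕ, (List.rec (motive := fun _ => List ℕ) []
      (fun t _ ih => Nat.mul t (Nat.sub 12 x) :: ih) l).length = l.length := by
    intro l
    induction l with
    | nil => rfl
    | cons a l ih => exact congrArg (· + 1) ih
  rw [stepCosts, this, List.length_take, min_eq_left h]

theorem getD_stepCosts {x y n : ℕ} (h : n < y) :
    (stepCosts x y).getD n 0 = price x n * (12 - x) := by
  have : ∀ (l : List ℕ) (n : ℕ), (List.rec (motive := fun _ => List ℕ) []
      (fun t _ ih => Nat.mul t (Nat.sub 12 x) :: ih) l).getD n 0 = l.getD n 0 * (12 - x) := by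
    intro l
    induction l with
    | nil => intro n; simp
    | cons a l ih =>
      intro n
      cases n with
      | zero => rfl
      | succ n => exact ih n
  rw [stepCosts, this, price, List.getD_eq_getElem?_getD, List.getElem?_take_of_lt h,
    ← List.getD_eq_getElem?_getD]

theorem length_partialSums (v : List ℕ) : ∀ a, (partialSums v a).length = v.length + 1 := by
  induction v with
  | nil => intro a; rfl
  | cons v vs ih =>
    intro a
    show (partialSums vs (a + v)).length + 1 = _
    rw [ih, List.length_cons]

theorem getD_partialSums (v : List ℕ) : ∀ a n, n ≤ v.length →
    (partialSums v a).getD n 0 = a + ∑ j ∈ Finset.range n, v.getD j 0 := by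
  induction v with
  | nil =>
    intro a n hn
    obtain rfl : n = 0 := by simpa using hn
    rfl
  | cons v vs ih =>
    intro a n hn
    show (a :: partialSums vs (a + v)).getD n 0 = _
    cases n with
    | zero => simp
    | succ n =>
      rw [List.getD_cons_succ, ih _ _ (by simpa using hn), Finset.sum_range_succ']
      simp only [List.getD_cons_succ, List.getD_cons_zero]
      omega

/-! ### Integer curves as lattice paths, and their cost -/

theorem length_priceRow : ∀ i ≤ 12, (priceRow i).length = 13 := by decide

theorem price_antitone_left : ∀ i ≤ 12, ∀ i' ≤ i, ∀ k ≤ 12, price i k ≤ price i' k := by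
  decide +kernel

theorem price_monotone_right : ∀ i ≤ 12, ∀ k ≤ 12, ∀ k' ≤ k, price i k' ≤ price i k := by
  decide +kernel

theorem price_le : ∀ i ≤ 12, ∀ k ≤ 12, price i k ≤ 10000 := by decide +kernel

theorem price_right : ∀ i ≤ 12, price i 12 = 10000 := by decide

theorem price_bottom : ∀ k < 12, price 12 k = 0 := by decide

/-- The number of columns in which the curve `b` is at most `j`. -/
def countLe (b : ℕ → ℕ) (j : ℕ) : ℕ := ((Finset.range 12).filter fun i => b i ≤ j).card

theorem countLe_le (b : ℕ → ℕ) (j : ℕ) : countLe b j ≤ 12 := card_filter_range_le _ _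

/-- The discrete form of `f (β⁻¹ y) y`, with `countLe b` in the role of `β⁻¹`. -/
def rowPrice (b : ℕ → ℕ) (j : ℕ) : ℕ := price (countLe b j) j

def tailPrice (b : ℕ → ℕ) (k : ℕ) : ℕ := ∑ j ∈ Finset.Ico k 12, rowPrice b j

theorem tailPrice_eq (b : ℕ → ℕ) {k : ℕ} (h : k < 12) :
    tailPrice b k = rowPrice b k + tailPrice b (k + 1) :=
  Finset.sum_eq_sum_Ico_succ_bot h _

/-- The double integral in `Γ` is charged to its column as a tail sum. The share `120000 = 12 *
10000` of the constant `1` makes the truncated subtraction exact when `b i ≤ a i ≤ 12`. -/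
def colCost (a b : ℕ → ℕ) (i : ℕ) : ℕ :=
  120000 + tailPrice b (a i) - price i (a i) * (12 - a i + b i)

def rowCost (b : ℕ → ℕ) (j : ℕ) : ℕ := rowPrice b j * (12 - countLe b j)

def pathCost (a b : ℕ → ℕ) (x y : ℕ) : ℕ :=
  ∑ i ∈ Finset.range x, colCost a b i + ∑ j ∈ Finset.range y, rowCost b j

/-- The lattice path of `b` passes through `(x, y)`. -/
structure OnPath (b : ℕ → ℕ) (x y : ℕ) : Prop where
  left : ∀ i < x, b i ≤ y
  right : ∀ i, x ≤ i → i < 12 → y ≤ b i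

/-- The path is followed backwards, downwards whenever possible. A downward step reveals `countLe b
y'`, hence the price of row `y'`. If it is impossible, then some earlier column, and by monotonicity
the last one, has height exactly `y`. -/
theorem OnPath.step {b : ℕ → ℕ} (hb : ∀ i j, i ≤ j → j < 12 → b i ≤ b j) {x y : ℕ} (hx : x ≤ 12)
    (h : OnPath b x y) : (x = 0 ∧ y = 0) ∨
      (∃ y', y = y' + 1 ∧ OnPath b x y' ∧ countLe b y' = x) ∨
      (∃ x', x = x' + 1 ∧ OnPath b x' y ∧ b x' = y) := by
  by_cases hc : ∃ y', y = y' + 1 ∧ ∀ i < x, b i ≤ y'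
  · obtain ⟨y', rfl, h'⟩ := hc
    refine Or.inr (Or.inl ⟨y', rfl, ⟨h', fun i h1 h2 => (Nat.le_succ _).trans (h.right i h1 h2)⟩, ?_⟩)
    have : (Finset.range 12).filter (fun i => b i ≤ y') = Finset.range x := by
      ext i
      rw [Finset.mem_filter, Finset.mem_range, Finset.mem_range]
      constructor
      · rintro ⟨h1, h2⟩
        by_contra h3
        have := h.right i (not_lt.1 h3) h1
        omega
      · exact fun h1 => ⟨by omega, h' i h1⟩
    rw [countLe, this, Finset.card_range]
  · push Not at hc
    cases x with
    | zero =>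
      cases y with
      | zero => exact Or.inl ⟨rfl, rfl⟩
      | succ y =>
        obtain ⟨i, h1, _⟩ := hc y rfl
        omega
    | succ x =>
      have h1 : b x = y := by
        refine le_antisymm (h.left x (Nat.lt_succ_self x)) ?_
        cases y with
        | zero => exact Nat.zero_le _
        | succ y =>
          obtain ⟨i, h1, h2⟩ := hc y rfl
          exact h2.trans_le (hb i x (by omega) (by omega))
      refine Or.inr (Or.inr ⟨x, rfl, ⟨fun i hi => h.left i (by omega), fun i h2 h3 => ?_⟩, h1⟩)
      exact h1 ▸ hb x i h2 h3

theorem OnPath.countLe_le {b : ℕ → ℕ} {x y j : ℕ} (h : OnPath b x y) (hj : j < y) :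
    countLe b j ≤ x := by
  have : (Finset.range 12).filter (fun i => b i ≤ j) ⊆ Finset.range x := by
    intro i hi
    rw [Finset.mem_filter, Finset.mem_range] at hi
    rw [Finset.mem_range]
    by_contra h3
    have := h.right i (not_lt.1 h3) hi.1
    omega
  exact (Finset.card_le_card this).trans (Finset.card_range x).le

section

variable {a b : ℕ → ℕ} (hb : ∀ i j, i ≤ j → j < 12 → b i ≤ b j) (hba : ∀ i < 12, b i ≤ a i)
  (ha : ∀ i < 12, a i ≤ 12)

include hba ha in
-- Since `a i ≥ b i ≥ m`, the tail sum in the cost of the column is among those that `s` bounds, and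
-- `a i` is one of the heights over which `minCost` minimises.
theorem minCost_le_colCost {i : ℕ} (hi : i < 12) {s : List ℕ} {m : ℕ} (hs : s.length + m = 13)
    (h : ∀ n < s.length, s.getD n 0 ≤ tailPrice b (m + n)) (hm : m ≤ b i) :
    minCost ((priceRow i).drop (b i)) (s.drop (b i - m)) 12 ≤ colCost a b i := by
  have h1 := hba i hi
  have h2 := ha i hi
  have hl : (priceRow i).length = 13 := length_priceRow i hi.le
  refine (minCost_le _ _ 12 (a i - b i) (by rw [List.length_drop]; omega)
    (by rw [List.length_drop]; omega)).trans ?_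
  have h3 : ((priceRow i).drop (b i)).getD (a i - b i) 0 = price i (a i) := by
    rw [price, List.getD_eq_getElem?_getD, List.getElem?_drop, List.getD_eq_getElem?_getD]
    congr 2
    omega
  have h4 : (s.drop (b i - m)).getD (a i - b i) 0 = s.getD (a i - m) 0 := by
    rw [List.getD_eq_getElem?_getD, List.getElem?_drop, List.getD_eq_getElem?_getD]
    congr 2
    omega
  have h5 := h (a i - m) (by omega)
  rw [show m + (a i - m) = a i by omega] at h5
  rw [h3, h4, colCost, show 12 - (a i - b i) = 12 - a i + b i by omega]
  omega

theorem length_pathCosts {s : List ℕ} (hs : s.length = 13) {y : ℕ} (hy : y ≤ 12) :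
    ∀ x ≤ 12, (pathCosts s y x).length = y + 1 := by
  intro x
  induction x with
  | zero =>
    intro _
    show (partialSums (stepCosts 0 y) 0).length = y + 1
    rw [length_partialSums, length_stepCosts (by rw [length_priceRow 0 (by omega)]; omega)]
  | succ x ih =>
    intro hx
    show (nextCosts (pathCosts s y x) (minCosts (priceRow x) s) (stepCosts (x + 1) y)).length = _
    have h1 := ih (by omega)
    have h2 := length_priceRow x (by omega)
    rw [length_nextCosts, h1]
    · rw [h1, length_minCosts, h2, hs]
      omega
    · rw [h1, length_stepCosts (by rw [length_priceRow _ hx]; omega)]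

include hb hba ha in
-- Soundness of the dynamic program, by induction on the column: the last step to a point of the
-- path is either vertical, with known row price, or horizontal at a height that is the value of `b`
-- in that column.
theorem pathCosts_le {s : List ℕ} (hs : s.length = 13)
    (h : ∀ n < s.length, s.getD n 0 ≤ tailPrice b n) {y : ℕ} (hy : y ≤ 12) :
    ∀ x ≤ 12, ∀ n ≤ y, OnPath b x n → (pathCosts s y x).getD n 0 ≤ pathCost a b x n := by
  intro x
  induction x with
  | zero =>
    intro _ n hn hp
    show (partialSums (stepCosts 0 y) 0).getD n 0 ≤ _
    have hl : (stepCosts 0 y).length = y :=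
      length_stepCosts (by rw [length_priceRow 0 (by omega)]; omega)
    rw [getD_partialSums _ _ _ (by omega), pathCost, Finset.sum_range_zero]
    refine Nat.add_le_add_left (Finset.sum_le_sum fun j hj => ?_) 0
    rw [Finset.mem_range] at hj
    have hc : countLe b j = 0 := Nat.le_zero.1 (hp.countLe_le hj)
    rw [getD_stepCosts (by omega), rowCost, rowPrice, hc]
  | succ x ih =>
    intro hx n hn hp
    have hle := length_pathCosts hs hy x (by omega)
    have hlr := length_priceRow x (by omega)
    have hlm : (minCosts (priceRow x) s).length = 13 := by rw [length_minCosts, hlr, hs]; rfl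
    have hlv : (stepCosts (x + 1) y).length = y :=
      length_stepCosts (by rw [length_priceRow _ hx]; omega)
    have hm : ∀ n ≤ y, b x = n → (minCosts (priceRow x) s).getD n 0 ≤ colCost a b x := by
      intro n hn hbx
      rw [getD_minCosts _ _ _ (by omega) (by omega), ← hbx]
      exact minCost_le_colCost hba ha (by omega) (m := 0) (by omega) (by simpa using h)
        (Nat.zero_le _)
    have hcol : ∀ n ≤ y, OnPath b x n → b x = n →
        (pathCosts s y x).getD n 0 + (minCosts (priceRow x) s).getD n 0 ≤ pathCost a b (x + 1) n := by
      intro n hn h1 h2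
      have := ih (by omega) n hn h1
      have := hm n hn h2
      rw [pathCost, Finset.sum_range_succ]
      rw [pathCost] at *
      omega
    show (nextCosts (pathCosts s y x) (minCosts (priceRow x) s) (stepCosts (x + 1) y)).getD n 0 ≤ _
    refine getD_nextCosts_le (P := OnPath b (x + 1)) (g := pathCost a b (x + 1)) _ _ _ (by omega)
      (by omega) (fun hp => ?_) (fun n hn hp => ?_) n (by omega) hp
    · rcases hp.step hb hx with h1 | ⟨y', h1, _⟩ | ⟨x', h1, h2, h3⟩
      · omega
      · omega
      · obtain rfl : x = x' := by omega
        exact hcol 0 (Nat.zero_le _) h2 h3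
    · rcases hp.step hb hx with h1 | ⟨y', h1, h2, h3⟩ | ⟨x', h1, h2, h3⟩
      · omega
      · obtain rfl : n = y' := by omega
        refine Or.inl ⟨h2, ?_⟩
        rw [getD_stepCosts (by omega), pathCost, pathCost, Finset.sum_range_succ _ n, rowCost,
          rowPrice, h3]
        omega
      · obtain rfl : x = x' := by omega
        exact Or.inr (hcol _ (by omega) h2 h3)

include hb hba ha in
theorem remainingCost_le {x y : ℕ} (hx : x ≤ 12) (hy : y ≤ 12) (hp : OnPath b x y) {s : List ℕ}
    (hs : s.length + y = 13) (h : ∀ n < s.length, s.getD n 0 = tailPrice b (y + n)) :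
    remainingCost x y s ≤ pathCost a b x y := by
  have hlt : ((priceRow x).take y).length = y := by
    rw [List.length_take, length_priceRow x hx]; omega
  have hl : (extendSums ((priceRow x).take y) s).length = 13 := by
    rw [length_extendSums, hlt]; omega
  refine pathCosts_le hb hba ha hl (fun n hn => ?_) hy x hx y le_rfl hp
  have := getD_extendSums_le (F := rowPrice b) (S := tailPrice b) s
    (List.ne_nil_of_length_pos (by omega)) ((priceRow x).take y) 0
    (fun k _ hk => tailPrice_eq b (by omega)) (fun n hn => ?_)
    (fun n hn => by rw [h n hn, hlt, Nat.zero_add]) n (by omega)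
  · simpa using this
  · rw [hlt] at hn
    rw [Nat.zero_add, List.getD_eq_getElem?_getD, List.getElem?_take_of_lt hn,
      ← List.getD_eq_getElem?_getD]
    -- Rows below `y` are crossed no later than column `x`, so the prices of row `x` of the table
    -- bound the unknown row prices from below.
    exact price_antitone_left x hx _ (hp.countLe_le hn) n (by omega)

include hb hba ha in
-- Following the path backwards keeps `s` exact: it holds the tail sums from height `y` on, which
-- depend only on the part already followed. A column of height `y` needs only these, because `a ≥
-- b`, so that `a` can be optimised at once and need not be branched on.
theorem branchBound_sound {C : ℕ} (n : ℕ) : ∀ (x y acc : ℕ) (s : List ℕ), x ≤ 12 → y ≤ 12 →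
    OnPath b x y → s.length + y = 13 → (∀ n < s.length, s.getD n 0 = tailPrice b (y + n)) →
    branchBound C n x y acc s = true → C ≤ acc + pathCost a b x y := by
  induction n with
  | zero => intro x y acc s _ _ _ _ _ h; cases h
  | succ n ih =>
    intro x y acc s hx hy hp hl hs h
    have h' : (Nat.ble C (acc + remainingCost x y s) || (Nat.ble 1 (x + y) &&
      ((Nat.beq y 0 || branchBound C n x (y - 1) (acc + price x (y - 1) * (12 - x))
        ((price x (y - 1) + s.headD 0) :: s)) &&
      (Nat.beq x 0 || branchBound C n (x - 1) y
        (acc + minCost ((priceRow (x - 1)).drop y) s 12) s)))) = true := h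
    rw [Bool.or_eq_true, Bool.and_eq_true, Bool.and_eq_true, Bool.or_eq_true, Bool.or_eq_true,
      Nat.ble_eq, Nat.ble_eq, Nat.beq_eq, Nat.beq_eq] at h'
    rcases h' with h1 | ⟨h0, h1, h2⟩
    · have := remainingCost_le hb hba ha hx hy hp hl hs
      omega
    · rcases hp.step hb hx with ⟨rfl, rfl⟩ | ⟨y', rfl, h3, h4⟩ | ⟨x', rfl, h3, h4⟩
      · omega
      · rcases h1 with h1 | h1
        · omega
        · have := ih _ _ _ _ hx (by omega) h3 (by rw [List.length_cons]; omega)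
            (fun n hn => ?_) h1
          · rw [pathCost, Finset.sum_range_succ _ y', rowCost, rowPrice, h4]
            rw [pathCost, Nat.add_sub_cancel] at this
            omega
          · rw [Nat.add_sub_cancel]
            cases n with
            | zero =>
              have h5 := hs 0 (by omega)
              rw [List.getD_cons_zero, Nat.add_zero, tailPrice_eq b (by omega), rowPrice, h4,
                List.headD_eq_head?_getD, List.head?_eq_getElem?, ← List.getD_eq_getElem?_getD, h5]
            | succ n =>
              rw [List.getD_cons_succ, hs n (by simpa using hn)]
              congr 1
              omega
      · rcases h2 with h2 | h2
        · omega
        · have := ih _ _ _ _ (by omega) hy h3 hl hs h2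
          have h5 := minCost_le_colCost hba ha (i := x') (by omega) hl (fun n hn => (hs n hn).le) h4.ge
          rw [h4, Nat.sub_self, List.drop_zero] at h5
          rw [pathCost, Finset.sum_range_succ]
          rw [pathCost, Nat.add_sub_cancel] at this
          omega

include hb hba ha in
theorem le_pathCost : 988128 ≤ pathCost a b 12 12 := by
  have := branchBound_sound hb hba ha 25 12 12 0 [0] le_rfl le_rfl
    ⟨fun i hi => (hba i hi).trans (ha i hi), fun i h1 h2 => by omega⟩ rfl
    (fun n hn => by
      obtain rfl : n = 0 := by simpa using hn
      rfl) branchBound_eq_true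
  omega

end

/-! ### Integrals over `[0,1]` as means over shifted grids, and a symmetric form of `Γ` -/

theorem integrable_of_mem_Icc {X : Type*} [MeasurableSpace X] {μ : Measure X} [IsFiniteMeasure μ]
    {g : X → ℝ} (hg : Measurable g) {c d : ℝ} (h : ∀ x, g x ∈ Icc c d) : Integrable g μ :=
  Integrable.of_mem_Icc c d hg.aemeasurable (Filter.Eventually.of_forall h)

/-- The point of the `i`-th of the `N` cells of `[0,1]` that corresponds to `t`. -/
noncomputable def cellPoint (N i : ℕ) (t : I) : I := projIcc 0 1 zero_le_one ((i + t) / N : ℝ)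

theorem coe_cellPoint {N i : ℕ} (hi : i < N) (t : I) : (cellPoint N i t : ℝ) = (i + t) / N := by
  have hN : (0 : ℝ) < N := by exact_mod_cast (Nat.zero_le i).trans_lt hi
  have hi' : (i : ℝ) + 1 ≤ N := by exact_mod_cast hi
  rw [cellPoint, projIcc_of_mem zero_le_one (x := ((i + t) / N : ℝ))]
  have h0 := t.2.1
  have h1 := t.2.2
  exact ⟨by positivity, (div_le_one hN).2 (by linarith)⟩

theorem cellPoint_mono (N : ℕ) (t : I) : Monotone fun i => cellPoint N i t := by
  intro i j h
  refine monotone_projIcc zero_le_one ?_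
  have : (i : ℝ) ≤ j := by exact_mod_cast h
  gcongr

theorem cellPoint_mono_right (N i : ℕ) : Monotone (cellPoint N i) := by
  intro s t h
  refine monotone_projIcc zero_le_one ?_
  have : (s : ℝ) ≤ t := h
  gcongr

theorem measurable_cellPoint (N i : ℕ) : Measurable (cellPoint N i) :=
  (cellPoint_mono_right N i).measurable

theorem integral_unitInterval (g : ℝ → ℝ) : ∫ x : I, g x = ∫ x in (0 : ℝ)..1, g x := by
  rw [intervalIntegral.integral_of_le zero_le_one, ← integral_Icc_eq_integral_Ioc]
  exact integral_subtype measurableSet_Icc g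

theorem integral_eq_sum_cells {N : ℕ} (hN : 0 < N) {g : I → ℝ} (hg : Measurable g) {c d : ℝ}
    (h : ∀ x, g x ∈ Icc c d) :
    ∫ x, g x = (∑ i ∈ Finset.range N, ∫ t, g (cellPoint N i t)) / N := by
  have hN' : (0 : ℝ) < N := by exact_mod_cast hN
  let G : ℝ → ℝ := fun x => g (projIcc 0 1 zero_le_one x)
  have hG : Measurable G := hg.comp (continuous_projIcc.measurable)
  have hGi : ∀ a b, IntervalIntegrable G volume a b := fun a b =>
    ⟨integrable_of_mem_Icc hG fun x => h _, integrable_of_mem_Icc hG fun x => h _⟩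
  have h1 : ∫ x, g x = ∫ x in (0 : ℝ)..1, G x := by
    rw [← integral_unitInterval]
    simp [G, projIcc_val]
  have h2 := intervalIntegral.sum_integral_adjacent_intervals (f := G) (μ := volume)
    (a := fun i : ℕ => (i : ℝ) / N) (n := N) fun k _ => hGi _ _
  rw [Nat.cast_zero, zero_div, div_self hN'.ne'] at h2
  rw [h1, ← h2, Finset.sum_div]
  refine Finset.sum_congr rfl fun i _ => ?_
  have h3 : ∫ t : I, g (cellPoint N i t) = ∫ t in (0 : ℝ)..1, G (t / N + (i : ℝ) / N) := by
    rw [← integral_unitInterval]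
    refine integral_congr_ae (Filter.Eventually.of_forall fun t => ?_)
    simp only [cellPoint, G]
    congr 2
    ring
  rw [h3, intervalIntegral.integral_comp_div_add G hN'.ne']
  rw [zero_div, zero_add, smul_eq_mul, mul_div_cancel_left₀ _ hN'.ne']
  congr 1
  push_cast
  ring

theorem inv_mono (β : I → I) : Monotone (inv β) := fun _ _ h =>
  sSup_le_sSup fun _ hx => le_trans hx h

/-- For monotone `β` the sublevel set is an initial interval ending at its supremum, with or without
the endpoint. -/
theorem volume_le_eq_inv {β : I → I} (hβ : Monotone β) (y : I) :
    volume.real {x | β x ≤ y} = inv β y := by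
  have h1 : {x | β x ≤ y} ⊆ Iic (inv β y) := fun x hx => le_sSup hx
  have h2 : Iio (inv β y) ⊆ {x | β x ≤ y} := by
    intro x hx
    obtain ⟨z, hz, hxz⟩ := lt_sSup_iff.1 (show x < sSup {x | β x ≤ y} from hx)
    exact (hβ hxz.le).trans hz
  have hI := (inv β y).2.1
  refine le_antisymm ?_ ?_
  · refine (measureReal_mono h1).trans_eq ?_
    rw [measureReal_def, unitInterval.volume_Iic, ENNReal.toReal_ofReal hI]
  · refine le_trans (le_of_eq ?_) (measureReal_mono h2)
    rw [measureReal_def, unitInterval.volume_Iio, ENNReal.toReal_ofReal hI]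

section

variable {f : I → I → I} {α β : I → I}

theorem measurable_rankPrice (hf : Measurable fun p : I × I => f p.1 p.2) :
    Measurable fun y => (f (inv β y) y : ℝ) :=
  measurable_subtype_coe.comp (hf.comp ((inv_mono β).measurable.prodMk measurable_id))

theorem integral_indicator_le (y : I) (hα : Measurable α) :
    ∫ x, (if α x ≤ y then (1 : ℝ) else 0) = volume.real {x | α x ≤ y} := by
  have : (fun x => if α x ≤ y then (1 : ℝ) else 0) = {x | α x ≤ y}.indicator 1 := by
    funext x
    simp [indicator_apply]
  rw [this, integral_indicator_one (measurableSet_le hα measurable_const)]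

theorem measurable_volume_le (hα : Measurable α) :
    Measurable fun y => volume.real {x | α x ≤ y} := by
  have : MeasurableSet {p : I × I | α p.2 ≤ p.1} :=
    measurableSet_le (hα.comp measurable_snd) measurable_fst
  exact (measurable_measure_prodMk_left this).ennreal_toReal

/-- The integrals of `α` and `β` cancel against the constant part of the third integral, and Fubini
turns the double integral into one over the rank. What remains is one term along the time axis and
one along the rank axis. -/
theorem Gam_eq (hf : Measurable fun p : I × I => f p.1 p.2) (hα : Measurable α) (hβ : Monotone β) :
    Gam f α β = 1 - (∫ x, (f x (α x) : ℝ) * (1 - α x + β x)) +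
      ∫ y, (f (inv β y) y : ℝ) * (1 - inv β y + volume.real {x | α x ≤ y}) := by
  have hαr : Measurable fun x => (α x : ℝ) := measurable_subtype_coe.comp hα
  have hβr : Measurable fun x => (β x : ℝ) := measurable_subtype_coe.comp hβ.measurable
  have hfr : Measurable fun x => (f x (α x) : ℝ) :=
    measurable_subtype_coe.comp (hf.comp (measurable_id.prodMk hα))
  have hir : Measurable fun y => (inv β y : ℝ) :=
    measurable_subtype_coe.comp (inv_mono β).measurable
  have hF := measurable_rankPrice (β := β) hf
  have hv := measurable_volume_le hα
  have hαi : Integrable fun x => (α x : ℝ) := integrable_of_mem_Icc hαr fun x => (α x).2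
  have hβi : Integrable fun x => (β x : ℝ) := integrable_of_mem_Icc hβr fun x => (β x).2
  have hb : ∀ (p q r : I), (p : ℝ) * (1 - q + r) ∈ Icc (-2 : ℝ) 2 := by
    intro p q r
    have h1 := p.2; have h2 := q.2; have h3 := r.2
    exact ⟨by nlinarith [h1.1, h1.2, h2.1, h2.2, h3.1, h3.2],
      by nlinarith [h1.1, h1.2, h2.1, h2.2, h3.1, h3.2]⟩
  have h1i : Integrable fun x => (f x (α x) : ℝ) * (1 - α x + β x) :=
    integrable_of_mem_Icc (by fun_prop) fun x => hb _ _ _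
  have hlast : (∫ x : I, ∫ y in Ioc (α x) 1, (f (inv β y) y : ℝ)) =
      ∫ y, (f (inv β y) y : ℝ) * volume.real {x | α x ≤ y} := by
    have e1 : ∀ x, (∫ y in Ioc (α x) 1, (f (inv β y) y : ℝ)) =
        ∫ y, (f (inv β y) y : ℝ) * (if α x ≤ y then 1 else 0) := by
      intro x
      have : Ioc (α x) 1 =ᵐ[volume] Ici (α x) := by
        have : Ici (α x) = Icc (α x) 1 := by
          ext y; exact ⟨fun h => ⟨h, y.2.2⟩, fun h => h.1⟩
        rw [this]
        exact Ioc_ae_eq_Icc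
      rw [setIntegral_congr_set this, ← integral_indicator measurableSet_Ici]
      congr 1
      funext y
      by_cases h : α x ≤ y <;> simp [h]
    simp_rw [e1]
    rw [integral_integral_swap]
    · congr 1
      funext y
      rw [integral_const_mul, integral_indicator_le y hα]
    · refine integrable_of_mem_Icc (c := 0) (d := 1) ?_ fun p => ?_
      · refine (hF.comp measurable_snd).mul (Measurable.ite ?_ measurable_const measurable_const)
        exact measurableSet_le (hα.comp measurable_fst) measurable_snd
      · dsimp only [Function.uncurry]
        split_ifs <;> simp
  have h2i : Integrable fun y => (f (inv β y) y : ℝ) * (1 - inv β y) :=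
    integrable_of_mem_Icc (c := -2) (d := 2) (by fun_prop) fun y => by
      simpa using hb (f (inv β y) y) (inv β y) 0
  have h3i : Integrable fun y => (f (inv β y) y : ℝ) * volume.real {x | α x ≤ y} :=
    integrable_of_mem_Icc (c := 0) (d := 1) (hF.mul hv) fun y => by
      have h1 := (f (inv β y) y).2
      have h2 : volume.real {x | α x ≤ y} ≤ 1 := measureReal_le_one
      have h3 : 0 ≤ volume.real {x | α x ≤ y} := measureReal_nonneg
      exact ⟨mul_nonneg h1.1 h3, mul_le_one₀ h1.2 h3 h2⟩
  have hA : (∫ x : I, (1 - (α x : ℝ) + (β x : ℝ)) * (1 - (f x (α x) : ℝ))) =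
      1 - (∫ x, (α x : ℝ)) + (∫ x, (β x : ℝ)) - ∫ x, (f x (α x) : ℝ) * (1 - α x + β x) := by
    have : ∀ x, (1 - (α x : ℝ) + (β x : ℝ)) * (1 - (f x (α x) : ℝ)) =
        (1 - α x + β x) - (f x (α x) : ℝ) * (1 - α x + β x) := fun x => by ring
    have hci : Integrable fun x => 1 - (α x : ℝ) := (integrable_const _).sub hαi
    have hsi : Integrable fun x => 1 - (α x : ℝ) + (β x : ℝ) := hci.add hβi
    simp_rw [this]
    rw [integral_sub hsi h1i, integral_add hci hβi, integral_sub (integrable_const _) hαi]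
    simp
  have hB : (∫ y, (f (inv β y) y : ℝ) * (1 - inv β y + volume.real {x | α x ≤ y})) =
      (∫ y : I, (1 - (inv β y : ℝ)) * (f (inv β y) y : ℝ)) +
        ∫ y, (f (inv β y) y : ℝ) * volume.real {x | α x ≤ y} := by
    simp_rw [mul_comm (1 - (inv β _ : ℝ))]
    rw [← integral_add h2i h3i]
    simp_rw [← mul_add]
  rw [Gam, hA, hlast, hB]
  ring

end

theorem integral_prod_eq_sum_cells {N : ℕ} (hN : 0 < N) {g : I × I → ℝ} (hg : Measurable g)
    {c d : ℝ} (h : ∀ x, g x ∈ Icc c d) :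
    ∫ p, g p = ∫ q : I × I, (∑ i ∈ Finset.range N, ∑ j ∈ Finset.range N,
      g (cellPoint N i q.1, cellPoint N j q.2)) / N / N := by
  have hm : ∀ i j, Measurable fun q : I × I => g (cellPoint N i q.1, cellPoint N j q.2) :=
    fun i j => hg.comp (((measurable_cellPoint N i).comp measurable_fst).prodMk
      ((measurable_cellPoint N j).comp measurable_snd))
  have hgi : Integrable g := integrable_of_mem_Icc hg h
  have hi : ∀ i j, Integrable fun q : I × I => g (cellPoint N i q.1, cellPoint N j q.2) :=
    fun i j => integrable_of_mem_Icc (hm i j) fun _ => h _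
  have h1 : Measurable fun x => ∫ y, g (x, y) :=
    (hg.stronglyMeasurable.integral_prod_right').measurable
  have h2 : ∀ x, ∫ y, g (x, y) ∈ Icc c d := by
    intro x
    have hix : Integrable fun y => g (x, y) :=
      integrable_of_mem_Icc (hg.comp measurable_prodMk_left) fun _ => h _
    constructor
    · simpa using integral_mono (integrable_const c) hix fun y => (h (x, y)).1
    · simpa using integral_mono hix (integrable_const d) fun y => (h (x, y)).2
  have h3 : ∀ i, ∫ t, ∫ y, g (cellPoint N i t, y) = (∑ j ∈ Finset.range N,
      ∫ q : I × I, g (cellPoint N i q.1, cellPoint N j q.2)) / N := by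
    intro i
    have : ∀ t, ∫ y, g (cellPoint N i t, y) = (∑ j ∈ Finset.range N,
        ∫ s, g (cellPoint N i t, cellPoint N j s)) / N := fun t =>
      integral_eq_sum_cells hN (hg.comp measurable_prodMk_left) fun _ => h _
    simp_rw [this]
    rw [integral_div, integral_finsetSum _ fun j _ => (hi i j).integral_prod_left]
    congr 1
    exact Finset.sum_congr rfl fun j _ => (integral_prod _ (hi i j)).symm
  have h4 : ∫ p, g p = ∫ x, ∫ y, g (x, y) := integral_prod _ hgi
  rw [h4, integral_eq_sum_cells hN h1 h2]
  simp_rw [h3]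
  rw [integral_div, integral_div, ← Finset.sum_div]
  congr 2
  rw [integral_finsetSum _ fun i _ => integrable_finsetSum _ fun j _ => hi i j]
  exact Finset.sum_congr rfl fun i _ => (integral_finsetSum _ fun j _ => hi i j).symm

/-! ### The pricing function of the table, compared with sampled curves -/

noncomputable def cell (x : I) : ℕ := ⌊(12 * x : ℝ)⌋₊

theorem cell_mono : Monotone cell := fun x y h => by
  have : (x : ℝ) ≤ y := h
  exact Nat.floor_mono (by linarith)

theorem cell_le (x : I) : cell x ≤ 12 := by
  have := x.2.2
  refine Nat.floor_le_of_le ?_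
  push_cast
  linarith

theorem cell_one : cell 1 = 12 := by
  have : ((12 : ℝ) * ((1 : I) : ℝ)) = (12 : ℕ) := by norm_num
  rw [cell, this, Nat.floor_natCast]

theorem cell_lt {x : I} (h : x < 1) : cell x < 12 := by
  have h1 : (x : ℝ) < 1 := h
  have h0 := x.2.1
  rw [cell, Nat.floor_lt (by linarith)]
  push_cast
  linarith

theorem measurable_cell : Measurable cell := cell_mono.measurable

theorem measurable_comp_cell (g : ℕ → ℕ → ℝ) : Measurable fun p : I × I => g (cell p.1) (cell p.2) :=
  have h : Measurable fun q : ℕ × ℕ => g q.1 q.2 := Measurable.of_discrete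
  h.comp ((measurable_cell.comp measurable_fst).prodMk (measurable_cell.comp measurable_snd))

theorem cell_div_le (x : I) : (cell x : ℝ) / 12 ≤ x := by
  have := Nat.floor_le (a := (12 * x : ℝ)) (by have := x.2.1; linarith)
  rw [div_le_iff₀ (by norm_num), mul_comm (x : ℝ)]
  exact this

theorem cell_cellPoint {i : ℕ} (hi : i < 12) {t : I} (ht : t < 1) : cell (cellPoint 12 i t) = i := by
  have h1 : (t : ℝ) < 1 := ht
  have h0 := t.2.1
  rw [cell, coe_cellPoint hi, Nat.floor_eq_iff (by positivity)]
  push_cast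
  constructor <;> linarith

/-- The pricing function of the lower bound. -/
noncomputable def priceFun (x y : I) : I :=
  ⟨(price (cell x) (cell y) : ℝ) / 10000, by positivity, by
    rw [div_le_one (by norm_num)]
    exact_mod_cast price_le _ (cell_le x) _ (cell_le y)⟩

theorem coe_priceFun (x y : I) : (priceFun x y : ℝ) = (price (cell x) (cell y) : ℝ) / 10000 := rfl

theorem priceFun_le {x x' y y' : I} (h : price (cell x) (cell y) ≤ price (cell x') (cell y')) :
    priceFun x y ≤ priceFun x' y' := by
  rw [← Subtype.coe_le_coe, coe_priceFun, coe_priceFun]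
  gcongr

theorem isPricing_priceFun : IsPricing priceFun where
  antitone_time y _ x' h :=
    priceFun_le (price_antitone_left _ (cell_le x') _ (cell_mono h) _ (cell_le y))
  monotone_rank x _ y' h :=
    priceFun_le (price_monotone_right _ (cell_le x) _ (cell_le y') _ (cell_mono h))
  rank_one x := by
    refine Subtype.ext ?_
    rw [coe_priceFun, cell_one, price_right _ (cell_le x)]
    norm_num
  time_one y h := by
    refine Subtype.ext ?_
    rw [coe_priceFun, cell_one, price_bottom _ (cell_lt h)]
    norm_num
  measurable := Measurable.subtype_mk (measurable_comp_cell fun i k => (price i k : ℝ) / 10000)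

section

variable {α β : I → I} (hβ : Monotone β) (hle : ∀ x, β x ≤ α x)

/-- The integrand of `Gam`, as a function of time and rank. -/
noncomputable def density (f : I → I → I) (α β : I → I) (p : I × I) : ℝ :=
  1 - (f p.1 (α p.1) : ℝ) * (1 - (if p.2 < α p.1 then 1 else 0) +
    if p.2 < β p.1 then 1 else 0) + (f (inv β p.2) p.2 : ℝ) *
    (1 - (if β p.1 ≤ p.2 then 1 else 0) + if α p.1 ≤ p.2 then 1 else 0)

/-- The number of sampled ranks below `α`. -/
noncomputable def sampleCurve (α : I → I) (q : I × I) (i : ℕ) : ℕ :=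
  ((Finset.range 12).filter fun j => cellPoint 12 j q.2 < α (cellPoint 12 i q.1)).card

theorem lt_sampleCurve_iff (α : I → I) (q : I × I) (i : ℕ) {j : ℕ} (hj : j < 12) :
    j < sampleCurve α q i ↔ cellPoint 12 j q.2 < α (cellPoint 12 i q.1) :=
  lt_card_filter_range_iff (fun _ _ h _ h' => (cellPoint_mono 12 q.2 h).trans_lt h') hj

theorem countLe_sampleCurve (α : I → I) (q : I × I) {j : ℕ} (hj : j < 12) :
    countLe (sampleCurve α q) j = ((Finset.range 12).filter fun i =>
      α (cellPoint 12 i q.1) ≤ cellPoint 12 j q.2).card := by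
  unfold countLe
  congr 1
  refine Finset.filter_congr fun i _ => ?_
  rw [← not_lt, lt_sampleCurve_iff α q i hj, not_lt]

/-- Discrete Fubini: it converts the tails charged to the columns back into the row form of
`Gam_eq`. -/
theorem sum_tailPrice (a b : ℕ → ℕ) : ∑ i ∈ Finset.range 12, tailPrice b (a i) =
    ∑ j ∈ Finset.range 12, rowPrice b j * countLe a j := by
  have : ∀ i, tailPrice b (a i) = ∑ j ∈ Finset.range 12, if a i ≤ j then rowPrice b j else 0 := by
    intro i
    rw [tailPrice, ← Finset.sum_filter]
    refine Finset.sum_congr ?_ fun _ _ => rfl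
    ext j
    simp [and_comm]
  simp_rw [this]
  rw [Finset.sum_comm]
  refine Finset.sum_congr rfl fun j _ => ?_
  rw [← Finset.sum_filter, Finset.sum_const, smul_eq_mul, mul_comm, countLe]

include hβ hle in
-- Counting sample points rounds `α` and `β⁻¹` to integers that are never below the index of their
-- cell. As the table increases in the rank and decreases in the time, this overestimates the
-- subtracted prices and underestimates the added ones. The interval lengths become exact counts.
theorem le_sum_density {q : I × I} (hq1 : q.1 < 1) (hq2 : q.2 < 1) :
    (0.6862 : ℝ) ≤ (∑ i ∈ Finset.range 12, ∑ j ∈ Finset.range 12,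
      density priceFun α β (cellPoint 12 i q.1, cellPoint 12 j q.2)) / (12 : ℕ) / (12 : ℕ) := by
  set a := sampleCurve α q with ha_def
  set b := sampleCurve β q with hb_def
  set X : ℕ → I := fun i => cellPoint 12 i q.1 with hX
  set Y : ℕ → I := fun j => cellPoint 12 j q.2 with hY
  have hb : ∀ i j, i ≤ j → j < 12 → b i ≤ b j := fun i j h _ =>
    Finset.card_le_card (Finset.monotone_filter_right _ fun k _ hk =>
      lt_of_lt_of_le hk (hβ (cellPoint_mono 12 q.1 h)))
  have hba : ∀ i < 12, b i ≤ a i := fun i _ =>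
    Finset.card_le_card (Finset.monotone_filter_right _ fun k _ hk => lt_of_lt_of_le hk (hle _))
  have ha : ∀ i < 12, a i ≤ 12 := fun i _ => card_filter_range_le _ _
  have key := le_pathCost hb hba ha
  -- the prices at the sample points compare with the entries of the table
  have hp : ∀ i < 12, (priceFun (X i) (α (X i)) : ℝ) ≤ (price i (a i) : ℝ) / 10000 := by
    intro i hi
    have h1 : cell (α (X i)) ≤ a i := by
      by_contra hlt
      have h2 := cell_le (α (X i))
      have h3 : a i < 12 := by omega
      refine lt_irrefl (a i) ((lt_sampleCurve_iff α q i h3).2 ?_)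
      show ((cellPoint 12 (a i) q.2 : I) : ℝ) < α (X i)
      rw [coe_cellPoint h3]
      have h4 : ((a i : ℝ) + 1) ≤ cell (α (X i)) := by exact_mod_cast not_le.1 hlt
      have h5 := cell_div_le (α (X i))
      have h6 : (q.2 : ℝ) < 1 := hq2
      push_cast
      linarith
    rw [coe_priceFun, cell_cellPoint hi hq1]
    refine div_le_div_of_nonneg_right ?_ (by norm_num)
    exact_mod_cast price_monotone_right _ hi.le _ (ha i hi) _ h1
  have hF : ∀ j < 12, (rowPrice b j : ℝ) / 10000 ≤ (priceFun (inv β (Y j)) (Y j) : ℝ) := by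
    intro j hj
    have h1 : cell (inv β (Y j)) ≤ countLe b j := by
      by_contra hlt
      have h2 := cell_le (inv β (Y j))
      have h3 : countLe b j < 12 := by omega
      refine lt_irrefl (countLe b j) ((lt_card_filter_range_iff
        (fun i k h1 h2 h3 => (hb i k h1 h2).trans h3) h3).2 ?_)
      rw [← not_lt, lt_sampleCurve_iff β q _ hj, not_lt]
      have h7 : X (countLe b j) < inv β (Y j) := by
        show ((cellPoint 12 (countLe b j) q.1 : I) : ℝ) < inv β (Y j)
        rw [coe_cellPoint h3]
        have h4 : ((countLe b j : ℝ) + 1) ≤ cell (inv β (Y j)) := by exact_mod_cast not_le.1 hlt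
        have h5 := cell_div_le (inv β (Y j))
        have h6 : (q.1 : ℝ) < 1 := hq1
        push_cast
        linarith
      obtain ⟨z, hz, hxz⟩ := lt_sSup_iff.1 h7
      exact (hβ hxz.le).trans hz
    rw [coe_priceFun, cell_cellPoint hj hq2]
    refine div_le_div_of_nonneg_right ?_ (by norm_num)
    exact_mod_cast price_antitone_left _ (countLe_le b j) _ h1 _ hj.le
  -- both sides as sums over the columns and over the rows
  have hsum : ∑ i ∈ Finset.range 12, ∑ j ∈ Finset.range 12, density priceFun α β (X i, Y j) =
      144 - ∑ i ∈ Finset.range 12, (priceFun (X i) (α (X i)) : ℝ) * (12 - a i + b i) +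
      ∑ j ∈ Finset.range 12, (priceFun (inv β (Y j)) (Y j) : ℝ) *
        (12 - countLe b j + countLe a j) := by
    have e1 : ∀ i, ∑ j ∈ Finset.range 12, (priceFun (X i) (α (X i)) : ℝ) *
        (1 - (if Y j < α (X i) then 1 else 0) + if Y j < β (X i) then 1 else 0) =
        (priceFun (X i) (α (X i)) : ℝ) * (12 - a i + b i) := by
      intro i
      rw [← Finset.mul_sum, Finset.sum_add_distrib, Finset.sum_sub_distrib, Finset.sum_boole,
        Finset.sum_boole]
      simp [ha_def, hb_def, sampleCurve, hX, hY]
    have e2 : ∀ j ∈ Finset.range 12, ∑ i ∈ Finset.range 12, (priceFun (inv β (Y j)) (Y j) : ℝ) *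
        (1 - (if β (X i) ≤ Y j then 1 else 0) + if α (X i) ≤ Y j then 1 else 0) =
        (priceFun (inv β (Y j)) (Y j) : ℝ) * (12 - countLe b j + countLe a j) := by
      intro j hj
      rw [Finset.mem_range] at hj
      rw [← Finset.mul_sum, Finset.sum_add_distrib, Finset.sum_sub_distrib, Finset.sum_boole,
        Finset.sum_boole, countLe_sampleCurve α q hj, countLe_sampleCurve β q hj]
      simp [hX, hY]
    rw [← Finset.sum_congr rfl e2, ← Finset.sum_congr rfl fun i _ => e1 i]
    unfold density
    simp only [Finset.sum_add_distrib, Finset.sum_sub_distrib]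
    rw [Finset.sum_comm (f := fun i j => (priceFun (inv β (Y j)) (Y j) : ℝ) * _)]
    simp
    norm_num
  have hcost : (988128 : ℝ) ≤ 1440000 - ∑ i ∈ Finset.range 12, (price i (a i) : ℝ) *
      (12 - a i + b i) + ∑ j ∈ Finset.range 12, (rowPrice b j : ℝ) *
        (12 - countLe b j + countLe a j) := by
    have e1 : ∀ i ∈ Finset.range 12, (colCost a b i : ℝ) = 120000 + tailPrice b (a i) -
        (price i (a i) : ℝ) * (12 - a i + b i) := by
      intro i hi
      rw [Finset.mem_range] at hi
      have h1 := hba i hi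
      have h2 := ha i hi
      have h3 : price i (a i) * (12 - a i + b i) ≤ 10000 * 12 :=
        Nat.mul_le_mul (price_le i hi.le _ h2) (by omega)
      rw [colCost, Nat.cast_sub (by omega)]
      push_cast [Nat.cast_sub h2]
      ring
    have e2 : ∀ j ∈ Finset.range 12, (rowCost b j : ℝ) =
        (rowPrice b j : ℝ) * (12 - countLe b j) := by
      intro j _
      rw [rowCost]
      push_cast [Nat.cast_sub (countLe_le b j)]
      ring
    have e3 := congrArg (Nat.cast (R := ℝ)) (sum_tailPrice a b)
    push_cast at e3
    have e4 : (988128 : ℝ) ≤ (pathCost a b 12 12 : ℕ) := by exact_mod_cast key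
    rw [pathCost] at e4
    push_cast at e4
    rw [Finset.sum_congr rfl e1, Finset.sum_congr rfl e2, Finset.sum_sub_distrib,
      Finset.sum_add_distrib, e3] at e4
    simp only [mul_add (rowPrice b _ : ℝ) _ (countLe a _ : ℝ), Finset.sum_add_distrib]
    simp only [Finset.sum_const, Finset.card_range, nsmul_eq_mul] at e4
    push_cast at e4
    linarith
  have hc1 : ∑ i ∈ Finset.range 12, (priceFun (X i) (α (X i)) : ℝ) * (12 - a i + b i) ≤
      (∑ i ∈ Finset.range 12, (price i (a i) : ℝ) * (12 - a i + b i)) / 10000 := by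
    rw [Finset.sum_div]
    refine Finset.sum_le_sum fun i hi => ?_
    rw [Finset.mem_range] at hi
    rw [mul_div_right_comm]
    have h2 : (a i : ℝ) ≤ 12 := by exact_mod_cast ha i hi
    have h3 : (0 : ℝ) ≤ b i := Nat.cast_nonneg _
    exact mul_le_mul_of_nonneg_right (hp i hi) (by linarith)
  have hc2 : (∑ j ∈ Finset.range 12, (rowPrice b j : ℝ) * (12 - countLe b j + countLe a j)) / 10000 ≤
      ∑ j ∈ Finset.range 12, (priceFun (inv β (Y j)) (Y j) : ℝ) *
        (12 - countLe b j + countLe a j) := by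
    rw [Finset.sum_div]
    refine Finset.sum_le_sum fun j hj => ?_
    rw [Finset.mem_range] at hj
    rw [mul_div_right_comm]
    have h2 : (countLe b j : ℝ) ≤ 12 := by exact_mod_cast countLe_le b j
    have h3 : (0 : ℝ) ≤ countLe a j := Nat.cast_nonneg _
    exact mul_le_mul_of_nonneg_right (hF j hj) (by linarith)
  rw [hsum, le_div_iff₀ (by norm_num), le_div_iff₀ (by norm_num)]
  push_cast
  linarith

end

/-! ### The lower bound for measurable `α` and monotone `β` -/

theorem integral_ite_lt (c : I) : ∫ y : I, (if y < c then (1 : ℝ) else 0) = c := by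
  have : (fun y : I => if y < c then (1 : ℝ) else 0) = (Iio c).indicator 1 := by
    funext x
    simp [indicator_apply]
  rw [this, integral_indicator_one measurableSet_Iio, measureReal_def, unitInterval.volume_Iio,
    ENNReal.toReal_ofReal c.2.1]

theorem integrable_ite {X : Type*} [MeasurableSpace X] {μ : Measure X} [IsFiniteMeasure μ]
    {p : X → Prop} [DecidablePred p] (hp : MeasurableSet {x | p x}) :
    Integrable (fun x => if p x then (1 : ℝ) else 0) μ :=
  integrable_of_mem_Icc (c := 0) (d := 1) (Measurable.ite hp measurable_const measurable_const)
    fun x => by split_ifs <;> simp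

section

variable {f : I → I → I} {α β : I → I}

theorem measurable_density (hf : Measurable fun p : I × I => f p.1 p.2) (hα : Measurable α)
    (hβ : Monotone β) : Measurable (density f α β) := by
  have hβm := hβ.measurable
  have h1 : Measurable fun p : I × I => (f p.1 (α p.1) : ℝ) :=
    measurable_subtype_coe.comp (hf.comp (measurable_fst.prodMk (hα.comp measurable_fst)))
  have h2 : Measurable fun p : I × I => (f (inv β p.2) p.2 : ℝ) :=
    (measurable_rankPrice hf).comp measurable_snd
  have h3 : ∀ γ : I → I, Measurable γ →
      Measurable fun p : I × I => if p.2 < γ p.1 then (1 : ℝ) else 0 := fun γ hγ =>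
    Measurable.ite (measurableSet_lt measurable_snd (hγ.comp measurable_fst)) measurable_const
      measurable_const
  have h4 : ∀ γ : I → I, Measurable γ →
      Measurable fun p : I × I => if γ p.1 ≤ p.2 then (1 : ℝ) else 0 := fun γ hγ =>
    Measurable.ite (measurableSet_le (hγ.comp measurable_fst) measurable_snd) measurable_const
      measurable_const
  exact (measurable_const.sub (h1.mul ((measurable_const.sub (h3 α hα)).add (h3 β hβm)))).add
    (h2.mul ((measurable_const.sub (h4 β hβm)).add (h4 α hα)))

theorem mul_mem_Icc_two {p q : ℝ} (hp : p ∈ Icc (0 : ℝ) 1) (hq : q ∈ Icc (0 : ℝ) 2) :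
    p * q ∈ Icc (0 : ℝ) 2 :=
  ⟨mul_nonneg hp.1 hq.1, by nlinarith [hp.1, hp.2, hq.1, hq.2]⟩

theorem one_sub_add_ite_mem (p q : Prop) [Decidable p] [Decidable q] :
    (1 : ℝ) - (if p then 1 else 0) + (if q then 1 else 0) ∈ Icc (0 : ℝ) 2 := by
  split_ifs <;> norm_num

theorem density_mem (p : I × I) : density f α β p ∈ Icc (-1 : ℝ) 3 := by
  have h1 := mul_mem_Icc_two (f p.1 (α p.1)).2
    (one_sub_add_ite_mem (p.2 < α p.1) (p.2 < β p.1))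
  have h2 := mul_mem_Icc_two (f (inv β p.2) p.2).2
    (one_sub_add_ite_mem (β p.1 ≤ p.2) (α p.1 ≤ p.2))
  unfold density
  constructor
  · linarith [h1.2, h2.1]
  · linarith [h1.1, h2.2]

theorem Gam_eq_integral_density (hf : Measurable fun p : I × I => f p.1 p.2) (hα : Measurable α)
    (hβ : Monotone β) : Gam f α β = ∫ p, density f α β p := by
  have hβm := hβ.measurable
  have m1 : Measurable fun x => (f x (α x) : ℝ) :=
    measurable_subtype_coe.comp (hf.comp (measurable_id.prodMk hα))
  have m2 : Measurable fun y => (f (inv β y) y : ℝ) := measurable_rankPrice hf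
  have h3 : ∀ γ : I → I, Measurable γ →
      Measurable fun p : I × I => if p.2 < γ p.1 then (1 : ℝ) else 0 := fun γ hγ =>
    Measurable.ite (measurableSet_lt measurable_snd (hγ.comp measurable_fst)) measurable_const
      measurable_const
  have h4 : ∀ γ : I → I, Measurable γ →
      Measurable fun p : I × I => if γ p.1 ≤ p.2 then (1 : ℝ) else 0 := fun γ hγ =>
    Measurable.ite (measurableSet_le (hγ.comp measurable_fst) measurable_snd) measurable_const
      measurable_const
  let A : I × I → ℝ := fun p => (f p.1 (α p.1) : ℝ) *
    (1 - (if p.2 < α p.1 then 1 else 0) + if p.2 < β p.1 then 1 else 0)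
  let B : I × I → ℝ := fun p => (f (inv β p.2) p.2 : ℝ) *
    (1 - (if β p.1 ≤ p.2 then 1 else 0) + if α p.1 ≤ p.2 then 1 else 0)
  have hA : Integrable A := integrable_of_mem_Icc (c := 0) (d := 2)
    ((m1.comp measurable_fst).mul ((measurable_const.sub (h3 α hα)).add (h3 β hβm)))
    fun p => mul_mem_Icc_two (f p.1 (α p.1)).2 (one_sub_add_ite_mem _ _)
  have hB : Integrable B := integrable_of_mem_Icc (c := 0) (d := 2)
    ((m2.comp measurable_snd).mul ((measurable_const.sub (h4 β hβm)).add (h4 α hα)))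
    fun p => mul_mem_Icc_two (f (inv β p.2) p.2).2 (one_sub_add_ite_mem _ _)
  have eA : ∫ p, A p = ∫ x, (f x (α x) : ℝ) * (1 - α x + β x) := by
    rw [Measure.volume_eq_prod, integral_prod A hA]
    refine integral_congr_ae (Filter.Eventually.of_forall fun x => ?_)
    have i1 : ∀ c : I, Integrable fun y : I => if y < c then (1 : ℝ) else 0 := fun c =>
      integrable_ite measurableSet_Iio
    have i2 : Integrable fun y : I => 1 - if y < α x then (1 : ℝ) else 0 :=
      (integrable_const _).sub (i1 _)
    simp only [A]
    rw [integral_const_mul, integral_add i2 (i1 _), integral_sub (integrable_const _) (i1 _),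
      integral_ite_lt, integral_ite_lt]
    simp
  have eB : ∫ p, B p = ∫ y, (f (inv β y) y : ℝ) *
      (1 - inv β y + volume.real {x | α x ≤ y}) := by
    rw [Measure.volume_eq_prod, integral_prod_symm B hB]
    refine integral_congr_ae (Filter.Eventually.of_forall fun y => ?_)
    have i1 : ∀ γ : I → I, Measurable γ → Integrable fun x : I => if γ x ≤ y then (1 : ℝ) else 0 :=
      fun γ hγ => integrable_ite (measurableSet_le hγ measurable_const)
    have i2 : Integrable fun x : I => 1 - if β x ≤ y then (1 : ℝ) else 0 :=
      (integrable_const _).sub (i1 _ hβm)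
    simp only [B]
    rw [integral_const_mul, integral_add i2 (i1 _ hα), integral_sub (integrable_const _) (i1 _ hβm),
      integral_indicator_le y hα, integral_indicator_le y hβm, volume_le_eq_inv hβ]
    simp
  have hsplit : ∫ p, density f α β p = 1 - (∫ p, A p) + ∫ p, B p := by
    have i1 : Integrable fun p => 1 - A p := (integrable_const _).sub hA
    have : ∀ p, density f α β p = 1 - A p + B p := fun p => rfl
    simp_rw [this]
    rw [integral_add i1 hB, integral_sub (integrable_const _) hA]
    simp
  rw [hsplit, eA, eB, Gam_eq hf hα hβ]

theorem ae_lt_one_unitInterval : ∀ᵐ x : I, x < 1 := by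
  have : ∀ᵐ x : I, x ≠ 1 := by
    rw [ae_iff]
    simp
  filter_upwards [this] with x hx
  exact lt_of_le_of_ne x.2.2 hx

theorem ae_lt_one : ∀ᵐ q : I × I, q.1 < 1 ∧ q.2 < 1 := by
  have h := ae_lt_one_unitInterval
  have h1 := (Measure.quasiMeasurePreserving_fst (μ := (volume : Measure I))
    (ν := (volume : Measure I))).ae h
  have h2 := (Measure.quasiMeasurePreserving_snd (μ := (volume : Measure I))
    (ν := (volume : Measure I))).ae h
  filter_upwards [h1, h2] with q hq1 hq2 using ⟨hq1, hq2⟩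

theorem le_Gam_priceFun (hα : Measurable α) (hβ : Monotone β) (hle : ∀ x, β x ≤ α x) :
    0.6862 ≤ Gam priceFun α β := by
  have hd := measurable_density isPricing_priceFun.measurable hα hβ
  rw [Gam_eq_integral_density isPricing_priceFun.measurable hα hβ,
    integral_prod_eq_sum_cells (N := 12) (by norm_num) hd density_mem]
  have hi : Integrable fun q : I × I => (∑ i ∈ Finset.range 12, ∑ j ∈ Finset.range 12,
      density priceFun α β (cellPoint 12 i q.1, cellPoint 12 j q.2)) / (12 : ℕ) / (12 : ℕ) := by
    refine ((integrable_finsetSum _ fun i _ => integrable_finsetSum _ fun j _ =>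
      integrable_of_mem_Icc (hd.comp (((measurable_cellPoint 12 i).comp measurable_fst).prodMk
      ((measurable_cellPoint 12 j).comp measurable_snd))) fun q =>
        density_mem _).div_const _).div_const _
  have h : ∫ _ : I × I, (0.6862 : ℝ) = 0.6862 := by
    simp
  rw [← h]
  refine integral_mono_ae (integrable_const _) hi ?_
  filter_upwards [ae_lt_one] with q hq using le_sum_density hβ hle hq.1 hq.2

end

/-! ### Regularity of implemented curves -/

section

variable {l r : ℕ} {f : I → I → I} {G : Graph l r} {u : Fin r} {v : Fin l} {x : Fin r → I}
  {y : Fin l → I} {α β : I → I}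

theorem before_update_of_le {t t' : I} (h : t ≤ t') {e : Fin r}
    (he : Before (Function.update x u t) e u) : Before (Function.update x u t') e u := by
  have hne : e ≠ u := fun h => Before.irrefl _ (h ▸ he)
  unfold Before at *
  rw [Function.update_self, Function.update_of_ne hne] at *
  rcases he with h1 | ⟨h1, h2⟩
  · exact Or.inl (h1.trans_le h)
  · rcases (h1.le.trans h).lt_or_eq with h3 | h3
    · exact Or.inl h3
    · exact Or.inr ⟨h3, h2⟩

theorem before_update_iff {t t' : I} {e e' : Fin r} (he : e ≠ u) (he' : e' ≠ u) :
    Before (Function.update x u t) e e' ↔ Before (Function.update x u t') e e' := by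
  unfold Before
  rw [Function.update_of_ne he, Function.update_of_ne he', Function.update_of_ne he,
    Function.update_of_ne he']

/-- The decisions made before `u` arrives do not depend on its arrival time. -/
theorem outcome_eq_of_before {t t' : I} {z : Fin l → I} (e : Fin r)
    (h : Before (Function.update x u t) e u) (h' : Before (Function.update x u t') e u) :
    outcome f G (Function.update x u t) z e = outcome f G (Function.update x u t') z e := by
  induction e using (before_wellFounded (Function.update x u t)).induction with
  | _ e ih =>
    have hne : e ≠ u := fun hh => Before.irrefl _ (hh ▸ h)
    have hx : Function.update x u t e = Function.update x u t' e := by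
      rw [Function.update_of_ne hne, Function.update_of_ne hne]
    have hiff : ∀ e', Before (Function.update x u t) e' e ↔ Before (Function.update x u t') e' e := by
      intro e'
      by_cases he' : e' = u
      · subst he'
        exact ⟨fun k => absurd k h.asymm, fun k => absurd k h'.asymm⟩
      · exact before_update_iff he' hne
    have hav : ∀ w, Available G (Function.update x u t) (outcome f G (Function.update x u t) z) e w ↔
        Available G (Function.update x u t') (outcome f G (Function.update x u t') z) e w := by
      intro w
      refine and_congr_right fun _ => forall_congr' fun e' => ?_
      rw [← hiff e']
      refine forall_congr' fun he' => ?_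
      rw [ih e' he' (he'.trans h) (((hiff e').1 he').trans h')]
    refine Option.ext fun w => ?_
    rw [(isOutcome_outcome f G _ z e w), (isOutcome_outcome f G _ z e w)]
    unfold IsBest
    simp only [hav, hx]

/-- Two arrival times of `u` that are not separated by other arrivals and at which `f` is the same
lead to the same decision for `u`. -/
theorem outcome_self_eq {t t' : I} {z : Fin l → I} (hf : f t = f t')
    (h : ∀ e, Before (Function.update x u t) e u ↔ Before (Function.update x u t') e u) :
    outcome f G (Function.update x u t) z u = outcome f G (Function.update x u t') z u := by
  have hav : ∀ w, Available G (Function.update x u t) (outcome f G (Function.update x u t) z) u w ↔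
      Available G (Function.update x u t') (outcome f G (Function.update x u t') z) u w := by
    intro w
    refine and_congr_right fun _ => forall_congr' fun e' => ?_
    rw [← h e']
    refine forall_congr' fun he' => ?_
    rw [outcome_eq_of_before e' he' ((h e').1 he')]
  refine Option.ext fun w => ?_
  rw [(isOutcome_outcome f G _ z u w), (isOutcome_outcome f G _ z u w)]
  unfold IsBest Prefers utility
  simp only [hav, Function.update_self, hf]

/-- If `v` is taken before time `t`, the same decision has been made when `u` arrives later, so `v`
is also taken before `t'`. -/
theorem Implements.monotone (h : Implements f G u v x y α β) : Monotone β := by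
  intro t t' htt'
  by_contra hlt
  rw [not_le] at hlt
  -- The value `α t'` is avoided because nothing is prescribed for a rank lying exactly on a curve.
  obtain ⟨s, hs⟩ := ((Ioo_infinite hlt).sdiff (finite_singleton (α t'))).nonempty
  obtain ⟨e, he, hM⟩ := h.matched_before t s hs.1.2
  have he' := before_update_of_le htt' he
  rw [outcome_eq_of_before e he he'] at hM
  rcases lt_or_gt_of_ne (show s ≠ α t' from hs.2) with h1 | h1
  · exact ((isOutcome_outcome _ _ _ _ _ _).1 (h.matched_edge t' s hs.1.1 h1)).1.2 e he' hM
  · exact h.unmatched_after t' s h1 e (Or.inr he') hM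

theorem Implements.alpha_le (h : Implements f G u v x y α β) {t t' : I} (hf : f t = f t')
    (hb : ∀ e, Before (Function.update x u t) e u ↔ Before (Function.update x u t') e u) :
    α t' ≤ α t := by
  by_contra hlt
  rw [not_le] at hlt
  by_cases hβ : β t' < α t'
  · obtain ⟨s, hs1, hs2⟩ := exists_between (max_lt hlt hβ)
    have h1 := h.matched_edge t' s ((le_max_right _ _).trans_lt hs1) hs2
    rw [← outcome_self_eq hf hb] at h1
    exact h.unmatched_after t s ((le_max_left _ _).trans_lt hs1) u (Or.inl rfl) h1
  · obtain ⟨s, hs1, hs2⟩ := exists_between (hlt.trans_le (not_lt.1 hβ))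
    obtain ⟨e, he, hM⟩ := h.matched_before t' s hs2
    rw [← outcome_eq_of_before e ((hb e).2 he) he] at hM
    exact h.unmatched_after t s hs1 e (Or.inr ((hb e).2 he)) hM

end

theorem priceFun_eq_of_cell_eq {t t' : I} (h : cell t = cell t') : priceFun t = priceFun t' := by
  funext z
  exact Subtype.ext (by rw [coe_priceFun, coe_priceFun, h])

/-- The value `α t` depends only on the cell of `t`, which determines the prices at time `t`, and on
the set of vertices that arrive before `u`. Both are discrete data depending measurably on `t`.
Constancy of the prices on cells is essential to this argument. -/
theorem Implements.measurable_alpha {l r : ℕ} {G : Graph l r} {u : Fin r} {v : Fin l}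
    {x : Fin r → I} {y : Fin l → I} {α β : I → I} (h : Implements priceFun G u v x y α β) :
    Measurable α := by
  classical
  let π : I → ℕ × (Fin r → Prop) := fun t =>
    (cell t, fun e => Before (Function.update x u t) e u)
  have hπ : Measurable π := by
    refine measurable_cell.prodMk (measurable_pi_lambda _ fun e => ?_)
    have : IsUpperSet {t | Before (Function.update x u t) e u} :=
      fun t t' htt' ht => before_update_of_le htt' ht
    exact measurableSet_setOfPred.1 this.ordConnected.measurableSet
  have hfac : ∀ t t', π t = π t' → α t = α t' := by
    intro t t' hh
    have h1 : cell t = cell t' := congrArg Prod.fst hh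
    have h2 : ∀ e, Before (Function.update x u t) e u ↔ Before (Function.update x u t') e u :=
      fun e => iff_of_eq (congrFun (congrArg Prod.snd hh) e)
    exact le_antisymm (h.alpha_le (priceFun_eq_of_cell_eq h1.symm) fun e => (h2 e).symm)
      (h.alpha_le (priceFun_eq_of_cell_eq h1) h2)
  let g : ℕ × (Fin r → Prop) → I := fun q => if hq : ∃ t, π t = q then α hq.choose else 0
  have hg : Measurable g := Measurable.of_discrete
  have : α = g ∘ π := by
    funext t
    have hq : ∃ t', π t' = π t := ⟨t, rfl⟩
    simp only [g, Function.comp, dif_pos hq]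
    exact hfac _ _ hq.choose_spec.symm
  rw [this]
  exact hg.comp hπ

theorem le_optValue : ((0.6862 : ℝ) : EReal) ≤ optValue := by
  refine le_trans ?_ (le_iSup₂_of_le priceFun isPricing_priceFun le_rfl)
  refine le_iInf₂ fun p hp => ?_
  obtain ⟨l, r, G, u, v, x, y, h⟩ := hp
  exact EReal.coe_le_coe_iff.2 (le_Gam_priceFun h.measurable_alpha h.monotone h.le)

/-! ### Step functions with shifted jumps and levels -/

/-- The `a`-th of the levels `0, u / N, (1 + u) / N, …, (N - 1 + u) / N, 1, 1, …`. -/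
noncomputable def level (N : ℕ) (u : I) (a : ℕ) : I := if a = 0 then 0 else cellPoint N (a - 1) u

theorem level_zero (N : ℕ) (u : I) : level N u 0 = 0 := if_pos rfl

theorem level_of_pos (N : ℕ) (u : I) {a : ℕ} (ha : 1 ≤ a) : level N u a = cellPoint N (a - 1) u :=
  if_neg (by omega)

theorem level_mono (N : ℕ) (u : I) : Monotone (level N u) := by
  intro a b h
  rcases Nat.eq_zero_or_pos a with rfl | ha
  · rw [level_zero]
    exact (level N u b).2.1
  · rw [level_of_pos N u ha, level_of_pos N u (ha.trans_le h)]
    exact cellPoint_mono N u (by omega)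

theorem cellPoint_of_le {N i : ℕ} (hN : 0 < N) (h : N ≤ i) (t : I) : cellPoint N i t = 1 := by
  have hN' : (0 : ℝ) < N := by exact_mod_cast hN
  have h' : (N : ℝ) ≤ i := by exact_mod_cast h
  refine projIcc_of_right_le _ ((one_le_div hN').2 ?_)
  linarith [t.2.1]

theorem measurable_level (N a : ℕ) : Measurable fun u => level N u a := by
  unfold level
  split_ifs
  · exact measurable_const
  · exact measurable_cellPoint N _

/-- The number of jumps up to `x` of a step function with jumps at `(i + θ) / N`, for `i < N`. -/
noncomputable def cellJumps (N : ℕ) (θ x : I) : ℕ := jumps (fun i => cellPoint N i θ) N x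

theorem lt_cellJumps_iff {N : ℕ} {θ x : I} {e : ℕ} (he : e < N) :
    e < cellJumps N θ x ↔ cellPoint N e θ ≤ x := lt_jumps_iff (cellPoint_mono N θ) he

theorem cellJumps_le (N : ℕ) (θ x : I) : cellJumps N θ x ≤ N := jumps_le _ _ _

theorem cellJumps_mono (N : ℕ) (θ : I) : Monotone (cellJumps N θ) := by
  intro x y h
  unfold cellJumps jumps
  exact Finset.card_le_card (Finset.monotone_filter_right _ fun _ _ hk => le_trans hk h)

theorem cellJumps_cellPoint {N i : ℕ} (hi : i < N) (θ : I) {t : I} (ht : t < 1) :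
    cellJumps N θ (cellPoint N i t) = if θ ≤ t then i + 1 else i := by
  have hN : (0 : ℝ) < N := by exact_mod_cast (Nat.zero_le i).trans_lt hi
  have h1 : (t : ℝ) < 1 := ht
  have h0 := t.2.1
  have hθ := θ.2
  have key : ∀ e < N, e < cellJumps N θ (cellPoint N i t) ↔ (e : ℝ) + θ ≤ i + t := by
    intro e he
    rw [lt_cellJumps_iff he, ← Subtype.coe_le_coe, coe_cellPoint he, coe_cellPoint hi,
      div_le_div_iff_of_pos_right hN]
  have hJ := cellJumps_le N θ (cellPoint N i t)
  split_ifs with h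
  · have h' : (θ : ℝ) ≤ t := h
    refine le_antisymm ?_ ((key i hi).2 (by linarith))
    by_contra hlt
    have := (key (i + 1) (by omega)).1 (by omega)
    push_cast at this
    linarith [hθ.1]
  · have h' : (t : ℝ) < θ := not_le.1 h
    refine le_antisymm ?_ ?_
    · by_contra hlt
      have := (key i (by omega)).1 (by omega)
      linarith
    · rcases Nat.eq_zero_or_pos i with rfl | hi0
      · exact Nat.zero_le _
      · have := (key (i - 1) (by omega)).2 (by
          rw [Nat.cast_sub hi0]
          push_cast
          linarith [hθ.2])
        omega

/-- Levels and jump counts with the same offset are adjoint; this is what allows time and rank to be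
exchanged. At `y = 1` it fails for `a > N + 1`. -/
theorem level_le_iff {N : ℕ} (hN : 0 < N) (u : I) (a : ℕ) {y : I} (hy : y < 1) :
    level N u a ≤ y ↔ a ≤ cellJumps N u y := by
  rcases Nat.eq_zero_or_pos a with rfl | ha
  · rw [level_zero]
    exact iff_of_true y.2.1 (Nat.zero_le _)
  · rw [level_of_pos N u ha]
    rcases le_or_gt a N with h | h
    · rw [← lt_cellJumps_iff (by omega)]
      omega
    · rw [cellPoint_of_le hN (by omega)]
      have := cellJumps_le N u y
      exact iff_of_false (not_le.2 hy) (by omega)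

/-- The number of those `p ≤ N` at which `a` is at most `j`. -/
def countUpTo (N : ℕ) (a : ℕ → ℕ) (j : ℕ) : ℕ :=
  ((Finset.range (N + 1)).filter fun p => a p ≤ j).card

theorem lt_countUpTo_iff {N : ℕ} {a : ℕ → ℕ} (ha : Monotone a) {j p : ℕ} (hp : p ≤ N) :
    p < countUpTo N a j ↔ a p ≤ j :=
  lt_card_filter_range_iff (fun _ _ h _ h' => (ha h).trans h') (Nat.lt_succ_of_le hp)

theorem countUpTo_le (N : ℕ) (a : ℕ → ℕ) (j : ℕ) : countUpTo N a j ≤ N + 1 :=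
  card_filter_range_le _ _

/-- The inverse of a step function with jump offset `θ` and level offset `u` is a step function with
the two offsets interchanged. -/
theorem volume_level_le {N : ℕ} (hN : 0 < N) (θ u : I) {a : ℕ → ℕ} (ha : Monotone a) {y : I}
    (hy : y < 1) :
    volume.real {x | level N u (a (cellJumps N θ x)) ≤ y} =
      level N θ (countUpTo N a (cellJumps N u y)) := by
  set k := countUpTo N a (cellJumps N u y) with hk
  have h1 : {x | level N u (a (cellJumps N θ x)) ≤ y} = {x | cellJumps N θ x < k} := by
    ext x
    rw [mem_ofPred, mem_ofPred, level_le_iff hN u _ hy, hk,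
      lt_countUpTo_iff ha (cellJumps_le _ _ _)]
  rw [h1]
  rcases Nat.eq_zero_or_pos k with h | h
  · rw [h, level_zero]
    simp
  · rw [level_of_pos N θ h]
    rcases le_or_gt k N with h2 | h2
    · have : {x | cellJumps N θ x < k} = Iio (cellPoint N (k - 1) θ) := by
        ext x
        have := lt_cellJumps_iff (N := N) (θ := θ) (x := x) (e := k - 1) (by omega)
        rw [mem_ofPred, mem_Iio, ← not_le (a := cellPoint N (k - 1) θ), ← this]
        omega
      rw [this, measureReal_def, unitInterval.volume_Iio,
        ENNReal.toReal_ofReal (cellPoint N (k - 1) θ).2.1]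
    · have : {x | cellJumps N θ x < k} = univ :=
        eq_univ_of_forall fun x => (cellJumps_le N θ x).trans_lt h2
      rw [cellPoint_of_le hN (by omega), this]
      simp

/-! ### Averaging over the offsets: reduction to cell means -/

section

variable (N : ℕ) (g : I → I → I)

/-- The value at `(cellPoint N i t, level N u A)` of the integrand of the horizontal part of
`Gam`. -/
noncomputable def stepTerm (i A B : ℕ) (u t : I) : ℝ :=
  (g (cellPoint N i t) (level N u A) : ℝ) * (1 - level N u A + level N u B)

/-- The horizontal part of `Gam` for the step functions with levels `a`, `b`. -/
noncomputable def stepIntegral (a b : ℕ → ℕ) (θ u : I) : ℝ :=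
  (∑ i ∈ Finset.range N, ∫ t, if θ ≤ t then stepTerm N g i (a (i + 1)) (b (i + 1)) u t else
    stepTerm N g i (a i) (b i) u t) / N

variable {N g}

theorem mul_one_sub_add_mem (p q r : I) : (p : ℝ) * (1 - q + r) ∈ Icc (0 : ℝ) 2 := by
  have h1 := p.2; have h2 := q.2; have h3 := r.2
  exact ⟨mul_nonneg h1.1 (by linarith [h2.2, h3.1]),
    by nlinarith [h1.1, h1.2, h2.1, h2.2, h3.1, h3.2]⟩

theorem measurable_stepTerm (hg : Measurable fun p : I × I => g p.1 p.2) (i A B : ℕ) :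
    Measurable fun p : I × I => stepTerm N g i A B p.1 p.2 := by
  have h1 : Measurable fun p : I × I => g (cellPoint N i p.2) (level N p.1 A) :=
    hg.comp (((measurable_cellPoint N i).comp measurable_snd).prodMk
      ((measurable_level N A).comp measurable_fst))
  have h2 : ∀ A, Measurable fun p : I × I => (level N p.1 A : ℝ) := fun A =>
    measurable_subtype_coe.comp ((measurable_level N A).comp measurable_fst)
  exact (measurable_subtype_coe.comp h1).mul ((measurable_const.sub (h2 A)).add (h2 B))

theorem integral_step (hN : 0 < N) (hg : Measurable fun p : I × I => g p.1 p.2) (a b : ℕ → ℕ)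
    (θ u : I) :
    ∫ x, (g x (level N u (a (cellJumps N θ x))) : ℝ) *
      (1 - level N u (a (cellJumps N θ x)) + level N u (b (cellJumps N θ x))) =
    stepIntegral N g a b θ u := by
  have h1 : ∀ a : ℕ → ℕ, Measurable fun x => level N u (a (cellJumps N θ x)) := fun a =>
    (Measurable.of_discrete (f := fun p => level N u (a p))).comp (cellJumps_mono N θ).measurable
  have h2 : Measurable fun x => (g x (level N u (a (cellJumps N θ x))) : ℝ) *
      (1 - level N u (a (cellJumps N θ x)) + level N u (b (cellJumps N θ x))) :=
    (measurable_subtype_coe.comp (hg.comp (measurable_id.prodMk (h1 a)))).mul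
      ((measurable_const.sub (measurable_subtype_coe.comp (h1 a))).add
        (measurable_subtype_coe.comp (h1 b)))
  rw [integral_eq_sum_cells hN h2 fun x => mul_one_sub_add_mem _ _ _]
  rw [stepIntegral]
  congr 1
  refine Finset.sum_congr rfl fun i hi => integral_congr_ae ?_
  filter_upwards [ae_lt_one_unitInterval] with t ht
  rw [cellJumps_cellPoint (Finset.mem_range.1 hi) θ ht]
  split_ifs <;> rfl

/-- A jump at a uniform place `θ` in a cell lies before the point `t` with probability `t`; this
produces the weights `t` and `1 - t`. -/
theorem integral_ite_le (t : I) (c d : ℝ) :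
    ∫ θ : I, (if θ ≤ t then c else d) = t * c + (1 - t) * d := by
  have h1 : (fun θ => if θ ≤ t then c else d) = fun θ => d + (c - d) * (Iic t).indicator 1 θ := by
    funext θ
    by_cases h : θ ≤ t <;> simp [h]
  have h2 : Integrable ((Iic t).indicator (1 : I → ℝ)) :=
    (integrable_const 1).indicator measurableSet_Iic
  rw [h1, integral_add (integrable_const _) (h2.const_mul _), integral_const_mul,
    integral_indicator_one measurableSet_Iic, measureReal_def, unitInterval.volume_Iic,
    ENNReal.toReal_ofReal t.2.1]
  simp
  ring

theorem measurable_ite_stepTerm (hg : Measurable fun p : I × I => g p.1 p.2) (i A B C D : ℕ) :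
    Measurable fun p : (I × I) × I => if p.1.1 ≤ p.2 then stepTerm N g i A B p.1.2 p.2 else
      stepTerm N g i C D p.1.2 p.2 := by
  have h : ∀ A B, Measurable fun p : (I × I) × I => stepTerm N g i A B p.1.2 p.2 := fun A B =>
    (measurable_stepTerm hg i A B).comp
      ((measurable_snd.comp measurable_fst).prodMk measurable_snd)
  exact Measurable.ite (measurableSet_le (measurable_fst.comp measurable_fst) measurable_snd)
    (h A B) (h C D)

theorem integrable_ite_stepTerm (hg : Measurable fun p : I × I => g p.1 p.2) (i A B C D : ℕ) :
    Integrable (fun p : (I × I) × I => if p.1.1 ≤ p.2 then stepTerm N g i A B p.1.2 p.2 else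
      stepTerm N g i C D p.1.2 p.2) :=
  integrable_of_mem_Icc (c := 0) (d := 2) (measurable_ite_stepTerm hg i A B C D) fun p => by
    split_ifs <;> exact mul_one_sub_add_mem _ _ _

theorem integrable_stepIntegral (hg : Measurable fun p : I × I => g p.1 p.2) (a b : ℕ → ℕ) :
    Integrable fun q : I × I => stepIntegral N g a b q.1 q.2 :=
  (integrable_finsetSum _ fun i _ =>
    (integrable_ite_stepTerm hg i _ _ _ _).integral_prod_left).div_const _

theorem integral_integral_ite_stepTerm (hg : Measurable fun p : I × I => g p.1 p.2)
    (i A B C D : ℕ) :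
    ∫ q : I × I, ∫ t, (if q.1 ≤ t then stepTerm N g i A B q.2 t else stepTerm N g i C D q.2 t) =
      (∫ r : I × I, r.1 * stepTerm N g i A B r.2 r.1) +
        ∫ r : I × I, (1 - r.1) * stepTerm N g i C D r.2 r.1 := by
  have hi := integrable_ite_stepTerm (N := N) hg i A B C D
  have hm : ∀ A B, Measurable fun r : I × I => stepTerm N g i A B r.2 r.1 := fun A B =>
    (measurable_stepTerm hg i A B).comp measurable_swap
  have hc : Measurable fun r : I × I => (r.1 : ℝ) := measurable_subtype_coe.comp measurable_fst
  have hb : ∀ (s : I) (A B : ℕ) (r : I × I), s * stepTerm N g i A B r.2 r.1 ∈ Icc (0 : ℝ) 2 := by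
    intro s A B r
    have h1 := s.2
    have h2 := mul_one_sub_add_mem (g (cellPoint N i r.1) (level N r.2 A)) (level N r.2 A)
      (level N r.2 B)
    exact ⟨mul_nonneg h1.1 h2.1, (mul_le_of_le_one_left h2.1 h1.2).trans h2.2⟩
  have h1 : Integrable fun r : I × I => r.1 * stepTerm N g i A B r.2 r.1 :=
    integrable_of_mem_Icc (hc.mul (hm A B)) fun r => hb r.1 A B r
  have h2 : Integrable fun r : I × I => (1 - r.1) * stepTerm N g i C D r.2 r.1 :=
    integrable_of_mem_Icc ((measurable_const.sub hc).mul (hm C D)) fun r => hb (σ r.1) C D r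
  have h3 := integral_prod _ (h1.add h2)
  simp only [Pi.add_apply] at h3
  rw [← integral_add h1 h2, integral_integral_swap hi]
  refine Eq.trans ?_ h3.symm
  refine integral_congr_ae ?_
  filter_upwards [hi.prod_left_ae] with t ht
  rw [Measure.volume_eq_prod, integral_prod_symm _ ht]
  refine integral_congr_ae (Filter.Eventually.of_forall fun u => ?_)
  exact integral_ite_le t (stepTerm N g i A B u t) (stepTerm N g i C D u t)

/-- The weight `1 - t` or `t`, according to the parity of `m`. -/
noncomputable def parityWeight (m : ℕ) (t : I) : ℝ := if m % 2 = 0 then 1 - t else t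

/-- The weighted mean of `g` over a cell; the weights come from the parities of `m` and `n`. -/
noncomputable def cellMean (N : ℕ) (g : I → I → I) (m n : ℕ) : ℝ :=
  ∫ r : I × I, 4 * parityWeight m r.1 * parityWeight n r.2 *
    (g (cellPoint N (m / 2) r.1) (cellPoint N (n / 2) r.2) : ℝ)

/-- `N` times the limit of `level N u a` for `u = 0` (`q = 0`) or `u = 1` (`q = 1`). -/
def levelBound (N q a : ℕ) : ℕ := if a = 0 then 0 else min (a - 1 + q) N

/-- `N` times the limit of `1 - level N u a + level N u b` for `u = 0` or `u = 1`. -/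
def gapWeight (N q a b : ℕ) : ℕ := N + levelBound N q b - levelBound N q a

theorem levelBound_le (N q a : ℕ) : levelBound N q a ≤ N := by
  unfold levelBound
  split_ifs <;> omega

theorem coe_gapWeight (N q a b : ℕ) :
    (gapWeight N q a b : ℝ) = N + levelBound N q b - levelBound N q a := by
  have := levelBound_le N q a
  rw [gapWeight, Nat.cast_sub (by omega), Nat.cast_add]

/-- Levels are affine in the offset `u`, so an average over `u` needs only the two weights `1 - u`
and `u`, with integer coefficients. -/
theorem coe_level (hN : 0 < N) (u : I) (a : ℕ) :
    (level N u a : ℝ) * N = (1 - u) * levelBound N 0 a + u * levelBound N 1 a := by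
  have hN' : (N : ℝ) ≠ 0 := by exact_mod_cast hN.ne'
  rcases Nat.eq_zero_or_pos a with rfl | ha
  · simp [level_zero, levelBound]
  · rw [level_of_pos N u ha, levelBound, levelBound, if_neg (by omega), if_neg (by omega)]
    rcases le_or_gt a N with h | h
    · rw [coe_cellPoint (by omega), div_mul_cancel₀ _ hN', min_eq_left (by omega),
        min_eq_left (by omega)]
      push_cast
      ring
    · rw [cellPoint_of_le hN (by omega), min_eq_right (by omega), min_eq_right (by omega)]
      simp only [Icc.coe_one]
      ring

theorem parityWeight_mem (m : ℕ) (t : I) : parityWeight m t ∈ Icc (0 : ℝ) 1 := by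
  unfold parityWeight
  split_ifs
  · exact (σ t).2
  · exact t.2

theorem measurable_parityWeight (m : ℕ) : Measurable (parityWeight m) := by
  unfold parityWeight
  split_ifs
  · exact measurable_const.sub measurable_subtype_coe
  · exact measurable_subtype_coe

theorem integrable_cellMean (hg : Measurable fun p : I × I => g p.1 p.2) (m n i j : ℕ) :
    Integrable fun r : I × I => 4 * parityWeight m r.1 * parityWeight n r.2 *
      (g (cellPoint N i r.1) (cellPoint N j r.2) : ℝ) := by
  refine integrable_of_mem_Icc (c := 0) (d := 4) ?_ fun r => ?_
  · exact ((measurable_const.mul ((measurable_parityWeight m).comp measurable_fst)).mul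
      ((measurable_parityWeight n).comp measurable_snd)).mul (measurable_subtype_coe.comp
      (hg.comp (((measurable_cellPoint N i).comp measurable_fst).prodMk
      ((measurable_cellPoint N j).comp measurable_snd))))
  · have h1 := parityWeight_mem m r.1
    have h2 := parityWeight_mem n r.2
    have h3 := (g (cellPoint N i r.1) (cellPoint N j r.2)).2
    have h4 : parityWeight m r.1 * parityWeight n r.2 ≤ 1 := mul_le_one₀ h1.2 h2.1 h2.2
    have h5 : 0 ≤ parityWeight m r.1 * parityWeight n r.2 := mul_nonneg h1.1 h2.1
    rw [mul_assoc, mul_assoc, ← mul_assoc (parityWeight m r.1)]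
    exact ⟨mul_nonneg (by norm_num) (mul_nonneg h5 h3.1),
      by linarith [mul_le_one₀ h4 h3.1 h3.2]⟩

/-- For `A ≥ 1` the level runs through cell `A - 1` as the offset varies, so the price is averaged
over a full cell; level `0` would stay fixed. -/
theorem integral_parityWeight_mul_stepTerm (hN : 0 < N) (hg : Measurable fun p : I × I => g p.1 p.2)
    {i A : ℕ} (B : ℕ) (hA : 1 ≤ A) {s : ℕ} (hs : s < 2) :
    ∫ r : I × I, parityWeight s r.1 * stepTerm N g i A B r.2 r.1 =
      (∑ q ∈ Finset.range 2, gapWeight N q A B * cellMean N g (2 * i + s) (2 * (A - 1) + q)) /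
        (4 * N) := by
  have hN' : (N : ℝ) ≠ 0 := by exact_mod_cast hN.ne'
  have e : ∀ r : I × I, parityWeight s r.1 * stepTerm N g i A B r.2 r.1 =
      ((gapWeight N 0 A B : ℝ) * (4 * parityWeight (2 * i + s) r.1 *
        parityWeight (2 * (A - 1) + 0) r.2 *
        (g (cellPoint N i r.1) (cellPoint N (A - 1) r.2) : ℝ)) +
      (gapWeight N 1 A B : ℝ) * (4 * parityWeight (2 * i + s) r.1 *
        parityWeight (2 * (A - 1) + 1) r.2 *
        (g (cellPoint N i r.1) (cellPoint N (A - 1) r.2) : ℝ))) / (4 * N) := by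
    intro r
    have p1 : parityWeight (2 * i + s) r.1 = parityWeight s r.1 := by
      unfold parityWeight
      rw [show (2 * i + s) % 2 = s % 2 by omega]
    have p2 : parityWeight (2 * (A - 1) + 0) r.2 = 1 - r.2 := if_pos (by omega)
    have p3 : parityWeight (2 * (A - 1) + 1) r.2 = r.2 := if_neg (by omega)
    have hw : (1 - level N r.2 A + level N r.2 B : ℝ) * N =
        (1 - r.2) * gapWeight N 0 A B + r.2 * gapWeight N 1 A B := by
      rw [add_mul, sub_mul, coe_level hN, coe_level hN, coe_gapWeight, coe_gapWeight]
      ring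
    rw [p1, p2, p3, stepTerm, ← level_of_pos N r.2 hA, eq_div_iff (by positivity)]
    linear_combination (parityWeight s r.1 * 4 *
      (g (cellPoint N i r.1) (level N r.2 A) : ℝ)) * hw
  simp_rw [e]
  rw [integral_div, integral_add ((integrable_cellMean hg _ _ _ _).const_mul _)
    ((integrable_cellMean hg _ _ _ _).const_mul _), integral_const_mul, integral_const_mul]
  rw [Finset.sum_range_succ, Finset.sum_range_one, cellMean, cellMean,
    show (2 * i + s) / 2 = i by omega, show (2 * (A - 1) + 0) / 2 = A - 1 by omega,
    show (2 * (A - 1) + 1) / 2 = A - 1 by omega]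

/-- The mean of the horizontal part of `Gam` is a combination of cell means. -/
theorem integral_stepIntegral (hN : 0 < N) (hg : Measurable fun p : I × I => g p.1 p.2)
    {a b : ℕ → ℕ} (ha : ∀ p, 1 ≤ a p) :
    ∫ q : I × I, stepIntegral N g a b q.1 q.2 = (∑ i ∈ Finset.range N, ∑ s ∈ Finset.range 2,
      ∑ q ∈ Finset.range 2, gapWeight N q (a (i + s)) (b (i + s)) *
        cellMean N g (2 * i + s) (2 * (a (i + s) - 1) + q)) / (4 * N ^ 2) := by
  unfold stepIntegral
  have hi : ∀ i, Integrable fun q : I × I => ∫ t, if q.1 ≤ t then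
      stepTerm N g i (a (i + 1)) (b (i + 1)) q.2 t else stepTerm N g i (a i) (b i) q.2 t := fun i =>
    (integrable_ite_stepTerm hg i _ _ _ _).integral_prod_left
  rw [integral_div, integral_finsetSum _ fun i _ => hi i, pow_two, ← mul_assoc, ← div_div]
  congr 1
  rw [Finset.sum_div]
  refine Finset.sum_congr rfl fun i _ => ?_
  rw [integral_integral_ite_stepTerm hg]
  have h0 := integral_parityWeight_mul_stepTerm (i := i) hN hg (b i) (ha i) (s := 0) (by norm_num)
  have h1 := integral_parityWeight_mul_stepTerm (i := i) hN hg (b (i + 1)) (ha (i + 1)) (s := 1)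
    (by norm_num)
  have e0 : ∀ t : I, parityWeight 0 t = 1 - t := fun t => rfl
  have e1 : ∀ t : I, parityWeight 1 t = t := fun t => rfl
  simp only [e0] at h0
  simp only [e1] at h1
  rw [h0, h1, add_comm, ← add_div]
  simp only [Finset.sum_range_succ, Finset.sum_range_zero, zero_add, add_zero]

end

/-! ### Cell means inherit monotonicity and boundary values -/

section

variable {N : ℕ} {f : I → I → I}

/-- Both `β⁻¹` and the measure of `{α ≤ y}` are step functions of `y` by `volume_level_le`, so the
vertical part is the horizontal part for the transposed `f`, with the inverse levels and exchanged
offsets. -/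
theorem Gam_step (hN : 0 < N) (hf : Measurable fun p : I × I => f p.1 p.2) {a b : ℕ → ℕ}
    (ha : Monotone a) (hb : Monotone b) (θ u : I) :
    Gam f (fun x => level N u (a (cellJumps N θ x))) (fun x => level N u (b (cellJumps N θ x))) =
      1 - stepIntegral N f a b θ u +
        stepIntegral N (fun y x => f x y) (countUpTo N b) (countUpTo N a) u θ := by
  have hβ : Monotone fun x => level N u (b (cellJumps N θ x)) := fun x y h =>
    level_mono N u (hb (cellJumps_mono N θ h))
  have hα : Monotone fun x => level N u (a (cellJumps N θ x)) := fun x y h =>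
    level_mono N u (ha (cellJumps_mono N θ h))
  have hf' : Measurable fun p : I × I => f p.2 p.1 := hf.comp measurable_swap
  rw [Gam_eq hf hα.measurable hβ, integral_step hN hf a b θ u,
    ← integral_step hN hf' (countUpTo N b) (countUpTo N a) u θ]
  congr 1
  refine integral_congr_ae ?_
  filter_upwards [ae_lt_one_unitInterval] with y hy
  have h1 : inv (fun x => level N u (b (cellJumps N θ x))) y =
      level N θ (countUpTo N b (cellJumps N u y)) :=
    Subtype.ext ((volume_le_eq_inv hβ y).symm.trans (volume_level_le hN θ u hb hy))
  rw [h1, volume_level_le hN θ u ha hy]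

theorem cellMean_flip (m n : ℕ) : cellMean N (fun y x => f x y) m n = cellMean N f n m := by
  unfold cellMean
  rw [Measure.volume_eq_prod, ← integral_prod_swap]
  refine integral_congr_ae (Filter.Eventually.of_forall fun r => ?_)
  simp only [Prod.fst_swap, Prod.snd_swap]
  ring

theorem integral_parityWeight (m : ℕ) : ∫ t, parityWeight m t = 1 / 2 := by
  have h : ∫ t : I, (t : ℝ) = 1 / 2 := by
    rw [integral_unitInterval fun x => x, integral_id]
    norm_num
  have hi : Integrable fun t : I => (t : ℝ) :=
    integrable_of_mem_Icc measurable_subtype_coe fun t => t.2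
  unfold parityWeight
  split_ifs
  · rw [integral_sub (integrable_const _) hi, h]
    norm_num
  · exact h

theorem integrable_parityWeight_mul {h : I → I} (hh : Measurable h) (n : ℕ) :
    Integrable fun u => parityWeight n u * (h u : ℝ) :=
  integrable_of_mem_Icc (c := 0) (d := 1)
    ((measurable_parityWeight n).mul (measurable_subtype_coe.comp hh)) fun u =>
    have h1 := parityWeight_mem n u
    ⟨mul_nonneg h1.1 (h u).2.1, mul_le_one₀ h1.2 (h u).2.1 (h u).2.2⟩

theorem integrable_parityWeight (n : ℕ) : Integrable (parityWeight n) :=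
  integrable_of_mem_Icc (measurable_parityWeight n) (parityWeight_mem n)

theorem integral_parityWeight_mul_mono {h : I → I} (hh : Monotone h) (n : ℕ) :
    ∫ u, parityWeight n u * (h (cellPoint N (n / 2) u) : ℝ) ≤
      ∫ u, parityWeight (n + 1) u * (h (cellPoint N ((n + 1) / 2) u) : ℝ) := by
  have hi : ∀ n i, Integrable fun u => parityWeight n u * (h (cellPoint N i u) : ℝ) := fun n i =>
    integrable_parityWeight_mul (hh.comp (cellPoint_mono_right N i)).measurable n
  rcases Nat.even_or_odd' n with ⟨r, rfl | rfl⟩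
  · rw [show 2 * r / 2 = r by omega, show (2 * r + 1) / 2 = r by omega]
    let c : I := ⟨1 / 2, by norm_num, by norm_num⟩
    -- Within one cell this is Chebyshev's argument: the difference `2 u - 1` of the weights has
    -- mean zero and the same sign as `h` minus its value at the midpoint.
    have h0 : ∫ u, (parityWeight (2 * r + 1) u - parityWeight (2 * r) u) *
        (h (cellPoint N r c) : ℝ) = 0 := by
      rw [integral_mul_const, integral_sub (integrable_parityWeight _) (integrable_parityWeight _),
        integral_parityWeight, integral_parityWeight]
      ring
    have h1 : 0 ≤ ∫ u, ((parityWeight (2 * r + 1) u * (h (cellPoint N r u) : ℝ) -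
        parityWeight (2 * r) u * (h (cellPoint N r u) : ℝ)) -
        (parityWeight (2 * r + 1) u - parityWeight (2 * r) u) * (h (cellPoint N r c) : ℝ)) := by
      refine integral_nonneg fun u => ?_
      have p1 : parityWeight (2 * r) u = 1 - u := if_pos (by omega)
      have p2 : parityWeight (2 * r + 1) u = u := if_neg (by omega)
      simp only [Pi.zero_apply, p1, p2]
      rcases le_total u c with huc | huc
      · have h2 : (h (cellPoint N r u) : ℝ) ≤ h (cellPoint N r c) :=
          hh (cellPoint_mono_right N r huc)
        have h3 : (u : ℝ) ≤ 1 / 2 := huc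
        nlinarith
      · have h2 : (h (cellPoint N r c) : ℝ) ≤ h (cellPoint N r u) :=
          hh (cellPoint_mono_right N r huc)
        have h3 : (1 / 2 : ℝ) ≤ u := huc
        nlinarith
    have i1 : Integrable fun u => parityWeight (2 * r + 1) u * (h (cellPoint N r u) : ℝ) -
        parityWeight (2 * r) u * (h (cellPoint N r u) : ℝ) := (hi _ _).sub (hi _ _)
    have i2 : Integrable fun u => (parityWeight (2 * r + 1) u - parityWeight (2 * r) u) *
        (h (cellPoint N r c) : ℝ) :=
      ((integrable_parityWeight _).sub (integrable_parityWeight _)).mul_const _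
    rw [integral_sub i1 i2, h0, integral_sub (hi _ _) (hi _ _)] at h1
    linarith
  · rw [show (2 * r + 1) / 2 = r by omega, show (2 * r + 1 + 1) / 2 = r + 1 by omega]
    -- For adjacent cells, the value at their common endpoint separates the two means, and both
    -- weights have the same mass.
    have hc : ∀ n, ∫ u, parityWeight n u * (h (cellPoint N (r + 1) 0) : ℝ) =
        1 / 2 * (h (cellPoint N (r + 1) 0) : ℝ) := fun n => by
      rw [integral_mul_const, integral_parityWeight]
    have hci : ∀ n, Integrable fun u => parityWeight n u * (h (cellPoint N (r + 1) 0) : ℝ) :=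
      fun n => (integrable_parityWeight n).mul_const _
    have h1 := integral_mono (hi (2 * r + 1) r) (hci (2 * r + 1)) fun u =>
      mul_le_mul_of_nonneg_left (show (h (cellPoint N r u) : ℝ) ≤ h (cellPoint N (r + 1) 0) from
        hh (monotone_projIcc zero_le_one (by
          have := u.2.2
          push_cast
          simp only [add_zero]
          gcongr))) (parityWeight_mem _ u).1
    have h2 := integral_mono (hci (2 * r + 1 + 1)) (hi (2 * r + 1 + 1) (r + 1)) fun u =>
      mul_le_mul_of_nonneg_left (show (h (cellPoint N (r + 1) 0) : ℝ) ≤ h (cellPoint N (r + 1) u)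
        from hh (cellPoint_mono_right N _ u.2.1)) (parityWeight_mem _ u).1
    rw [hc] at h1 h2
    exact h1.trans h2

theorem cellMean_eq_integral_integral (hf : Measurable fun p : I × I => f p.1 p.2) (m n : ℕ) :
    cellMean N f m n = ∫ t, 4 * parityWeight m t * ∫ u, parityWeight n u *
      (f (cellPoint N (m / 2) t) (cellPoint N (n / 2) u) : ℝ) := by
  rw [cellMean, Measure.volume_eq_prod, integral_prod _ (integrable_cellMean hf _ _ _ _)]
  refine integral_congr_ae (Filter.Eventually.of_forall fun t => ?_)
  simp only [mul_assoc, integral_const_mul]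

theorem cellMean_mono_right (hf : Measurable fun p : I × I => f p.1 p.2) (hm : ∀ x, Monotone (f x))
    (m : ℕ) : Monotone (cellMean N f m) := by
  refine monotone_nat_of_le_succ fun n => ?_
  rw [cellMean_eq_integral_integral hf, cellMean_eq_integral_integral hf]
  have hi : ∀ n, Integrable fun t => 4 * parityWeight m t * ∫ u, parityWeight n u *
      (f (cellPoint N (m / 2) t) (cellPoint N (n / 2) u) : ℝ) := fun n =>
    (integrable_cellMean (N := N) hf m n (m / 2) (n / 2)).integral_prod_left.congr
      (Filter.Eventually.of_forall fun t => by simp only [mul_assoc, integral_const_mul])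
  refine integral_mono (hi n) (hi (n + 1)) fun t => ?_
  exact mul_le_mul_of_nonneg_left (integral_parityWeight_mul_mono (hm _) n)
    (mul_nonneg (by norm_num) (parityWeight_mem m t).1)

theorem integral_four_mul_parityWeight (m n : ℕ) :
    ∫ r : I × I, 4 * parityWeight m r.1 * parityWeight n r.2 = 1 := by
  rw [Measure.volume_eq_prod, integral_prod_mul (fun t => 4 * parityWeight m t) (parityWeight n),
    integral_const_mul, integral_parityWeight, integral_parityWeight]
  norm_num

theorem integrable_four_mul_parityWeight (m n : ℕ) :
    Integrable fun r : I × I => 4 * parityWeight m r.1 * parityWeight n r.2 := by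
  simpa using integrable_cellMean (N := 1) (g := fun _ _ => 1) measurable_const m n 0 0

theorem cellMean_symm (hf : Measurable fun p : I × I => f p.1 p.2) (m n : ℕ) :
    cellMean N (fun x y => σ (f x y)) m n = 1 - cellMean N f m n := by
  rw [cellMean, cellMean, ← integral_four_mul_parityWeight m n,
    ← integral_sub (integrable_four_mul_parityWeight m n) (integrable_cellMean hf _ _ _ _)]
  refine integral_congr_ae (Filter.Eventually.of_forall fun r => ?_)
  simp only [unitInterval.coe_symm_eq]
  ring

theorem IsPricing.cellMean_mono (hf : IsPricing f) (m : ℕ) : Monotone (cellMean N f m) :=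
  cellMean_mono_right hf.measurable hf.monotone_rank m

theorem IsPricing.cellMean_antitone (hf : IsPricing f) (n : ℕ) :
    Antitone fun m => cellMean N f m n := by
  have hm : Measurable fun p : I × I => f p.2 p.1 := hf.measurable.comp measurable_swap
  intro m m' h
  have := cellMean_mono_right (N := N) (f := fun y x => σ (f x y))
    (unitInterval.continuous_symm.measurable.comp hm)
    (fun y x x' hx => unitInterval.symm_le_symm.2 (hf.antitone_time y hx)) n h
  rw [cellMean_symm (f := fun y x => f x y) hm, cellMean_symm (f := fun y x => f x y) hm,
    cellMean_flip (f := f), cellMean_flip (f := f)] at this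
  exact (sub_le_sub_iff_left _).1 this

theorem cellMean_nonneg (m n : ℕ) : 0 ≤ cellMean N f m n :=
  integral_nonneg fun r => mul_nonneg (mul_nonneg (mul_nonneg (by norm_num)
    (parityWeight_mem m r.1).1) (parityWeight_mem n r.2).1) (Subtype.prop (f _ _)).1

/-- Beyond the last cell `cellPoint` is clamped to `1`, so these indices encode the boundary value
at rank `1`. -/
theorem IsPricing.cellMean_eq_one (hf : IsPricing f) (hN : 0 < N) (m : ℕ) {n : ℕ}
    (hn : 2 * N ≤ n) : cellMean N f m n = 1 := by
  rw [cellMean, ← integral_four_mul_parityWeight m n]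
  refine integral_congr_ae (Filter.Eventually.of_forall fun r => ?_)
  simp only [cellPoint_of_le hN (show N ≤ n / 2 by omega), hf.rank_one, Icc.coe_one, mul_one]

theorem cellPoint_lt_one {i : ℕ} (hi : i < N) {t : I} (ht : t < 1) : cellPoint N i t < 1 := by
  have hN : (0 : ℝ) < N := by exact_mod_cast (Nat.zero_le i).trans_lt hi
  have hi' : (i : ℝ) + 1 ≤ N := by exact_mod_cast hi
  have ht' : (t : ℝ) < 1 := ht
  rw [← Subtype.coe_lt_coe, coe_cellPoint hi, Icc.coe_one, div_lt_one hN]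
  linarith

theorem IsPricing.cellMean_eq_zero (hf : IsPricing f) (hN : 0 < N) {m n : ℕ}
    (hm : 2 * N ≤ m) (hn : n < 2 * N) : cellMean N f m n = 0 := by
  rw [cellMean]
  refine integral_eq_zero_of_ae ?_
  filter_upwards [ae_lt_one] with r hr
  simp [cellPoint_of_le hN (show N ≤ m / 2 by omega),
    hf.time_one _ (cellPoint_lt_one (show n / 2 < N by omega) hr.2)]

/-- `Gam` for the step functions with levels `a`, `b`, averaged over the positions of the steps. -/
theorem integral_Gam_step (hN : 0 < N) (hf : Measurable fun p : I × I => f p.1 p.2) {a b : ℕ → ℕ}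
    (ha : Monotone a) (hb : Monotone b) (ha1 : ∀ p, 1 ≤ a p) (hb0 : b 0 = 0) :
    Integrable (fun q : I × I => Gam f (fun x => level N q.2 (a (cellJumps N q.1 x)))
      (fun x => level N q.2 (b (cellJumps N q.1 x)))) ∧
    ∫ q : I × I, Gam f (fun x => level N q.2 (a (cellJumps N q.1 x)))
      (fun x => level N q.2 (b (cellJumps N q.1 x))) = 1 - (∑ i ∈ Finset.range N,
      ∑ s ∈ Finset.range 2, ∑ q ∈ Finset.range 2, gapWeight N q (a (i + s)) (b (i + s)) *
        cellMean N f (2 * i + s) (2 * (a (i + s) - 1) + q)) / (4 * N ^ 2) +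
      (∑ i ∈ Finset.range N, ∑ s ∈ Finset.range 2, ∑ q ∈ Finset.range 2,
        gapWeight N q (countUpTo N b (i + s)) (countUpTo N a (i + s)) *
        cellMean N f (2 * (countUpTo N b (i + s) - 1) + q) (2 * i + s)) / (4 * N ^ 2) := by
  have hf' : Measurable fun p : I × I => f p.2 p.1 := hf.comp measurable_swap
  -- Since `b 0 = 0`, the inverse levels are positive as well, which the averaging formula needs for
  -- the vertical part.
  have hk : ∀ j, 1 ≤ countUpTo N b j := fun j =>
    (lt_countUpTo_iff hb (Nat.zero_le N)).2 (by rw [hb0]; exact Nat.zero_le _)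
  have i1 := integrable_stepIntegral (N := N) hf a b
  have i2 := (integrable_stepIntegral (N := N) (g := fun y x => f x y) hf'
    (countUpTo N b) (countUpTo N a)).swap
  have i3 : Integrable fun q : I × I => 1 - stepIntegral N f a b q.1 q.2 :=
    (integrable_const _).sub i1
  have e := integral_stepIntegral hN (g := fun y x => f x y) hf' (b := countUpTo N a) hk
  rw [Measure.volume_eq_prod, ← integral_prod_swap] at e
  simp only [cellMean_flip] at e
  simp only [Gam_step hN hf ha hb]
  refine ⟨i3.add i2, ?_⟩
  rw [← e, ← integral_stepIntegral hN hf ha1]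
  refine (integral_add i3 i2).trans ?_
  rw [integral_sub (integrable_const _) i1]
  simp [Measure.volume_eq_prod]

end

/-! ### The certificate of linear programming duality -/

/-- Strategies of the adversary: a weight and the levels of the two step functions. -/
def strategies : List (ℕ × List ℕ × List ℕ) := [
    (3, [1, 1, 1, 1, 1, 1, 1, 2, 3], [0, 0, 0, 0, 0, 0, 0, 0, 1]),
    (38, [1, 2, 2, 2, 2, 2, 2, 9, 9], [0, 0, 0, 0, 0, 0, 0, 2, 2]),
    (154, [1, 2, 3, 3, 3, 3, 3, 9, 9], [0, 0, 0, 0, 0, 0, 0, 3, 3]),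
    (243, [7, 7, 7, 9, 9, 9, 9, 9, 9], [0, 2, 3, 7, 7, 7, 7, 7, 7]),
    (37, [7, 7, 9, 9, 9, 9, 9, 9, 9], [0, 2, 7, 7, 7, 7, 7, 7, 7]),
    (276, [1, 1, 2, 3, 3, 3, 3, 9, 9], [0, 0, 0, 0, 0, 0, 0, 3, 3]),
    (127, [5, 5, 5, 5, 5, 9, 9, 9, 9], [0, 0, 0, 0, 2, 5, 5, 5, 5]),
    (127, [5, 6, 6, 6, 9, 9, 9, 9, 9], [0, 0, 0, 0, 6, 6, 6, 6, 6]),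
    (57, [1, 1, 1, 1, 1, 1, 1, 1, 9], [0, 0, 0, 0, 0, 0, 0, 0, 1]),
    (73, [1, 1, 1, 1, 2, 2, 2, 2, 9], [0, 0, 0, 0, 0, 0, 0, 0, 2]),
    (73, [8, 8, 9, 9, 9, 9, 9, 9, 9], [0, 4, 8, 8, 8, 8, 8, 8, 8]),
    (214, [2, 2, 3, 4, 4, 4, 9, 9, 9], [0, 0, 0, 0, 0, 0, 4, 4, 4]),
    (2, [1, 1, 1, 2, 2, 2, 2, 3, 9], [0, 0, 0, 0, 0, 0, 0, 0, 2]),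
    (1, [1, 1, 1, 2, 2, 2, 3, 3, 9], [0, 0, 0, 0, 0, 0, 0, 0, 3]),
    (184, [1, 1, 1, 2, 2, 2, 2, 2, 9], [0, 0, 0, 0, 0, 0, 0, 0, 2]),
    (310, [3, 5, 5, 5, 5, 9, 9, 9, 9], [0, 0, 0, 1, 1, 5, 5, 5, 5]),
    (13, [8, 8, 9, 9, 9, 9, 9, 9, 9], [0, 6, 8, 8, 8, 8, 8, 8, 8]),
    (82, [1, 1, 1, 1, 1, 1, 1, 2, 9], [0, 0, 0, 0, 0, 0, 0, 0, 2]),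
    (130, [2, 4, 4, 4, 4, 4, 9, 9, 9], [0, 0, 0, 0, 0, 1, 4, 4, 4]),
    (364, [6, 6, 6, 6, 9, 9, 9, 9, 9], [0, 0, 1, 3, 6, 6, 6, 6, 6]),
    (13, [6, 6, 6, 9, 9, 9, 9, 9, 9], [0, 0, 1, 6, 6, 6, 6, 6, 6]),
    (40, [8, 9, 9, 9, 9, 9, 9, 9, 9], [0, 7, 9, 9, 9, 9, 9, 9, 9]),
    (13, [2, 3, 3, 3, 3, 3, 9, 9, 9], [0, 0, 0, 0, 0, 0, 3, 3, 3]),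
    (30, [3, 4, 5, 5, 5, 9, 9, 9, 9], [0, 0, 0, 0, 0, 5, 5, 5, 5]),
    (214, [6, 6, 6, 6, 9, 9, 9, 9, 9], [0, 0, 2, 2, 6, 6, 6, 6, 6]),
    (377, [2, 3, 4, 4, 4, 4, 9, 9, 9], [0, 0, 0, 0, 0, 0, 4, 4, 4]),
    (186, [4, 4, 5, 5, 5, 9, 9, 9, 9], [0, 0, 0, 1, 2, 5, 5, 5, 5]),
    (109, [7, 7, 7, 9, 9, 9, 9, 9, 9], [0, 1, 6, 7, 7, 7, 7, 7, 7]),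
    (40, [1, 1, 1, 1, 1, 1, 1, 2, 2], [0, 0, 0, 0, 0, 0, 0, 0, 1]),
    (13, [1, 1, 1, 1, 1, 1, 2, 2, 9], [0, 0, 0, 0, 0, 0, 0, 0, 2]),
    (104, [1, 2, 2, 2, 3, 3, 3, 9, 9], [0, 0, 0, 0, 0, 0, 0, 3, 3]),
    (127, [4, 4, 5, 5, 5, 9, 9, 9, 9], [0, 0, 0, 0, 1, 5, 5, 5, 5]),
    (154, [7, 7, 7, 9, 9, 9, 9, 9, 9], [0, 1, 2, 7, 7, 7, 7, 7, 7]),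
    (187, [8, 8, 9, 9, 9, 9, 9, 9, 9], [0, 3, 8, 8, 8, 8, 8, 8, 8]),
    (57, [8, 9, 9, 9, 9, 9, 9, 9, 9], [0, 8, 8, 8, 8, 8, 8, 8, 8]),
    (109, [1, 2, 2, 2, 2, 2, 3, 9, 9], [0, 0, 0, 0, 0, 0, 0, 3, 3]),
    (97, [4, 5, 5, 5, 5, 9, 9, 9, 9], [0, 0, 0, 0, 0, 5, 5, 5, 5]),
    (82, [8, 8, 9, 9, 9, 9, 9, 9, 9], [0, 7, 8, 8, 8, 8, 8, 8, 8]),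
    (19, [2, 3, 3, 4, 4, 4, 9, 9, 9], [0, 0, 0, 0, 0, 0, 4, 4, 4]),
    (3, [8, 9, 9, 9, 9, 9, 9, 9, 9], [0, 7, 7, 9, 9, 9, 9, 9, 9]),
    (24, [3, 4, 4, 4, 4, 4, 9, 9, 9], [0, 0, 0, 0, 0, 0, 4, 4, 4]),
    (29, [3, 5, 5, 5, 5, 9, 9, 9, 9], [0, 0, 0, 0, 2, 5, 5, 5, 5]),
    (104, [7, 7, 7, 9, 9, 9, 9, 9, 9], [0, 1, 4, 7, 7, 7, 7, 7, 7]),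
    (5, [7, 7, 8, 9, 9, 9, 9, 9, 9], [0, 1, 6, 7, 7, 7, 7, 7, 7]),
    (4, [1, 1, 2, 2, 2, 2, 3, 9, 9], [0, 0, 0, 0, 0, 0, 0, 2, 3]),
    (134, [5, 6, 6, 6, 9, 9, 9, 9, 9], [0, 0, 1, 2, 6, 6, 6, 6, 6]),
    (131, [3, 3, 3, 4, 4, 4, 9, 9, 9], [0, 0, 0, 0, 0, 1, 4, 4, 4]),
    (27, [6, 6, 6, 6, 9, 9, 9, 9, 9], [0, 0, 1, 1, 6, 6, 6, 6, 6]),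
    (33, [7, 7, 7, 9, 9, 9, 9, 9, 9], [0, 1, 3, 7, 7, 7, 7, 7, 7]),
    (29, [6, 6, 6, 6, 9, 9, 9, 9, 9], [0, 0, 0, 2, 6, 6, 6, 6, 6])]

/-- Multipliers of the constraints that the cell means are monotone in the rank. -/
def rankFlow : List (List ℕ) := [
    [0, 0, 0, 609, 0, 496, 20, 114, 34, 42, 438, 57, 219, 305, 76, 77, 77],
    [0, 2100, 0, 812, 14, 0, 0, 0, 0, 0, 0, 0, 0, 0, 0, 0, 0],
    [0, 0, 0, 0, 3, 439, 9, 9, 275, 13, 877, 0, 0, 144, 8, 162, 0],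
    [0, 256, 0, 0, 0, 0, 0, 0, 342, 0, 0, 0, 0, 0, 0, 2340, 22],
    [0, 0, 28, 0, 0, 0, 0, 0, 1158, 0, 312, 0, 0, 50, 0, 0, 0],
    [0, 0, 824, 0, 3, 0, 0, 0, 0, 0, 0, 0, 0, 3240, 0, 3, 9],
    [0, 0, 604, 0, 3, 0, 2260, 0, 50, 12, 794, 279, 0, 0, 0, 0, 0],
    [0, 0, 619, 0, 0, 0, 845, 0, 0, 0, 2, 3843, 32, 32, 27, 27, 27],
    [0, 0, 891, 0, 816, 0, 889, 0, 387, 2, 0, 0, 0, 0, 0, 0, 0],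
    [0, 0, 327, 0, 252, 0, 352, 0, 0, 3840, 3, 3, 3, 3, 3, 3, 3],
    [0, 0, 1359, 312, 784, 128, 1183, 0, 0, 0, 0, 0, 0, 0, 0, 0, 0],
    [0, 0, 542, 188, 1111, 6, 556, 3796, 0, 0, 0, 0, 0, 0, 0, 0, 0],
    [0, 0, 376, 0, 989, 0, 0, 0, 0, 0, 0, 0, 0, 0, 0, 0, 0],
    [0, 0, 1251, 0, 479, 3260, 5, 5, 0, 0, 0, 0, 0, 0, 0, 0, 0],
    [0, 0, 1106, 0, 0, 12, 0, 0, 0, 0, 0, 0, 0, 0, 0, 0, 0],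
    [0, 0, 1505, 2568, 0, 12, 0, 0, 0, 0, 0, 0, 0, 0, 0, 0, 0]]

/-- Multipliers of the constraints that the cell means are antitone in the time. -/
def timeFlow : List (List ℕ) := [
    [0, 0, 0, 0, 0, 0, 0, 0, 0, 0, 0, 0, 0, 0, 0, 0],
    [0, 2100, 0, 269, 0, 0, 0, 0, 0, 0, 0, 0, 0, 0, 0, 0],
    [0, 0, 0, 0, 41, 824, 609, 623, 887, 324, 1359, 542, 376, 1251, 1106, 1505],
    [616, 812, 0, 0, 0, 0, 0, 0, 0, 0, 329, 188, 0, 0, 0, 2568],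
    [0, 27, 3, 0, 0, 3, 3, 0, 816, 252, 801, 1110, 989, 479, 0, 0],
    [490, 0, 452, 0, 0, 0, 0, 0, 0, 0, 145, 4, 0, 3260, 12, 12],
    [9, 0, 22, 0, 0, 0, 2260, 845, 889, 479, 1200, 427, 0, 5, 0, 0],
    [103, 0, 32, 0, 0, 0, 0, 0, 0, 0, 0, 3811, 0, 5, 0, 0],
    [23, 0, 306, 342, 1158, 0, 50, 0, 386, 0, 0, 0, 0, 0, 0, 0],
    [31, 0, 36, 0, 0, 0, 12, 0, 0, 3837, 0, 0, 0, 0, 0, 0],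
    [427, 0, 894, 0, 312, 0, 1048, 1, 0, 0, 0, 0, 0, 0, 0, 0],
    [46, 0, 0, 0, 0, 0, 550, 3842, 0, 0, 0, 0, 0, 0, 0, 0],
    [208, 0, 0, 0, 0, 0, 0, 46, 0, 0, 0, 0, 0, 0, 0, 0],
    [294, 0, 144, 0, 50, 3240, 0, 46, 0, 0, 0, 0, 0, 0, 0, 0],
    [65, 0, 8, 0, 0, 0, 0, 41, 0, 0, 0, 0, 0, 0, 0, 0],
    [66, 0, 162, 2340, 0, 3, 0, 41, 0, 0, 0, 0, 0, 0, 0, 0],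
    [66, 0, 0, 22, 0, 9, 0, 41, 0, 0, 0, 0, 0, 0, 0, 0]]

/-- A list of nine levels as a sequence; it is continued by `9`. -/
def levels (v : List ℕ) (p : ℕ) : ℕ := v.getD p 9

/-- The coefficient of the cell mean at `(m, n)` in the averaged horizontal part of `Gam` for the
levels `k`, `l`, with the two coordinates exchanged. -/
def cellWeight (N : ℕ) (k l : ℕ → ℕ) (m n : ℕ) : ℕ :=
  ∑ q ∈ Finset.range 2, if 2 * (k (n / 2 + n % 2) - 1) + q = m then
    gapWeight N q (k (n / 2 + n % 2)) (l (n / 2 + n % 2)) else 0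

/-- The total coefficient of the cell mean at `(m, n)` in the vertical parts. -/
def totalGain (m n : ℕ) : ℕ := (strategies.map fun s =>
  s.1 * cellWeight 8 (countUpTo 8 (levels s.2.2)) (countUpTo 8 (levels s.2.1)) m n).sum

/-- The total coefficient of the cell mean at `(m, n)` in the horizontal parts. -/
def totalLoss (m n : ℕ) : ℕ := (strategies.map fun s =>
  s.1 * cellWeight 8 (levels s.2.1) (levels s.2.2) n m).sum

def rankMultiplier (m n : ℕ) : ℕ := (rankFlow.getD m []).getD n 0

def timeMultiplier (m n : ℕ) : ℕ := (timeFlow.getD m []).getD n 0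

/-- The multipliers balance the coefficients. -/
theorem totalGain_add_eq : ∀ m < 16, ∀ n < 16, totalGain m n + rankMultiplier m n +
    timeMultiplier (m + 1) n = totalLoss m n + rankMultiplier m (n + 1) + timeMultiplier m n := by
  decide +kernel

theorem rankMultiplier_zero : ∀ m < 16, rankMultiplier m 0 = 0 := by decide +kernel

theorem timeMultiplier_zero : ∀ n < 16, timeMultiplier 0 n = 0 := by decide +kernel

theorem sum_rankMultiplier : ∑ m ∈ Finset.range 16, rankMultiplier m 16 = 138 := by decide +kernel

theorem sum_totalLoss :
    ∑ m ∈ Finset.range 16, (totalLoss m 16 + totalLoss m 17) = 381072 := by decide +kernel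

theorem sum_weights : (strategies.map fun s => s.1).sum = 5002 := by decide +kernel

/-- The levels of a strategy define step functions. -/
def IsValid (s : ℕ × List ℕ × List ℕ) : Prop := (s.2.1.length = 9 ∧ s.2.2.length = 9) ∧
  (∀ p < 9, levels s.2.1 p ≤ levels s.2.1 (p + 1) ∧ levels s.2.2 p ≤ levels s.2.2 (p + 1) ∧
    levels s.2.2 p ≤ levels s.2.1 p) ∧ levels s.2.2 0 = 0 ∧ 1 ≤ levels s.2.1 0

theorem isValid_of_mem_strategies : ∀ s ∈ strategies, IsValid s := by
  unfold IsValid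
  decide +kernel

theorem levels_of_le {v : List ℕ} (hv : v.length = 9) {p : ℕ} (hp : 9 ≤ p) : levels v p = 9 :=
  List.getD_eq_default _ _ (by omega)

theorem levels_mono {v : List ℕ} (hv : v.length = 9)
    (h : ∀ p < 9, levels v p ≤ levels v (p + 1)) : Monotone (levels v) := by
  refine monotone_nat_of_le_succ fun p => ?_
  rcases lt_or_ge p 9 with hp | hp
  · exact h p hp
  · rw [levels_of_le hv hp, levels_of_le hv (by omega)]

theorem sum_range_two_mul (N : ℕ) (F : ℕ → ℝ) :
    ∑ n ∈ Finset.range (2 * N), F n =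
      ∑ i ∈ Finset.range N, ∑ s ∈ Finset.range 2, F (2 * i + s) := by
  induction N with
  | zero => simp
  | succ N ih =>
    rw [show 2 * (N + 1) = 2 * N + 1 + 1 by ring, Finset.sum_range_succ, Finset.sum_range_succ, ih,
      Finset.sum_range_succ _ N]
    simp [Finset.sum_range_succ, add_assoc]

/-- Collects the terms by cell mean. The half-cell `n = 2 i + s` uses the level number `i + s`, and
levels up to `N + 1` require the two indices beyond `2 N - 1`. -/
theorem sum_gapWeight_mul {N : ℕ} {k : ℕ → ℕ} (l : ℕ → ℕ) (hk : ∀ p, k p ≤ N + 1)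
    (φ : ℕ → ℕ → ℝ) :
    ∑ i ∈ Finset.range N, ∑ s ∈ Finset.range 2, ∑ q ∈ Finset.range 2,
      gapWeight N q (k (i + s)) (l (i + s)) * φ (2 * (k (i + s) - 1) + q) (2 * i + s) =
    ∑ n ∈ Finset.range (2 * N), ∑ m ∈ Finset.range (2 * N + 2), cellWeight N k l m n * φ m n := by
  rw [sum_range_two_mul]
  refine Finset.sum_congr rfl fun i _ => Finset.sum_congr rfl fun s hs => ?_
  rw [Finset.mem_range] at hs
  simp only [cellWeight, show (2 * i + s) / 2 + (2 * i + s) % 2 = i + s by omega]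
  push_cast
  simp only [Finset.sum_mul]
  rw [Finset.sum_comm]
  refine Finset.sum_congr rfl fun q hq => ?_
  rw [Finset.mem_range] at hq
  simp only [ite_mul, zero_mul]
  rw [Finset.sum_ite_eq, if_pos]
  have := hk (i + s)
  rw [Finset.mem_range]
  omega

theorem sum_map_mul_sum (L : List (ℕ × List ℕ × List ℕ))
    (w : ℕ × List ℕ × List ℕ → ℕ → ℕ → ℕ) (K M : ℕ) (φ : ℕ → ℕ → ℝ) :
    (L.map fun s => (s.1 : ℝ) * ∑ n ∈ Finset.range K, ∑ m ∈ Finset.range M, w s m n * φ m n).sum =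
      ∑ n ∈ Finset.range K, ∑ m ∈ Finset.range M,
        ((L.map fun s => s.1 * w s m n).sum : ℕ) * φ m n := by
  induction L with
  | nil => simp
  | cons s L ih =>
    rw [List.map_cons, List.sum_cons, ih]
    simp only [List.map_cons, List.sum_cons, Nat.cast_add, Nat.cast_mul, add_mul,
      Finset.sum_add_distrib, Finset.mul_sum, mul_assoc]

/-- Weak duality by summation by parts: each multiplier ends up next to an increment of `ψ` of known
sign. The initial boundary terms vanish, the final one in the rank is bounded by `ψ ≤ 1`, and the
final one in the time is dropped by `0 ≤ ψ`. -/
theorem sum_flow_le (U W : ℕ → ℕ → ℕ) {M K : ℕ} {ψ : ℕ → ℕ → ℝ} (h0 : ∀ m n, 0 ≤ ψ m n)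
    (h1 : ∀ m, ψ m K ≤ 1) (hm : ∀ m, Monotone (ψ m)) (ha : ∀ n, Antitone fun m => ψ m n)
    (hU : ∀ m < M, U m 0 = 0) (hW : ∀ n < K, W 0 n = 0) :
    ∑ m ∈ Finset.range M, ∑ n ∈ Finset.range K,
      ((U m (n + 1) : ℝ) - U m n + W m n - W (m + 1) n) * ψ m n ≤
        ∑ m ∈ Finset.range M, (U m K : ℝ) := by
  have e1 : ∀ m < M, ∀ k, ∑ n ∈ Finset.range k, ((U m (n + 1) : ℝ) - U m n) * ψ m n ≤
      U m k * ψ m k := by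
    intro m hmM k
    induction k with
    | zero => simp [hU m hmM]
    | succ k ih =>
      rw [Finset.sum_range_succ]
      have := mul_le_mul_of_nonneg_left (hm m (Nat.le_succ k)) (Nat.cast_nonneg (α := ℝ) (U m (k + 1)))
      linarith
  have e2 : ∀ n < K, ∀ k, ∑ m ∈ Finset.range k, ((W m n : ℝ) - W (m + 1) n) * ψ m n ≤
      - (W k n * ψ k n) := by
    intro n hn k
    induction k with
    | zero => simp [hW n hn]
    | succ k ih =>
      rw [Finset.sum_range_succ]
      have := mul_le_mul_of_nonneg_left (ha n (Nat.le_succ k)) (Nat.cast_nonneg (α := ℝ) (W (k + 1) n))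
      simp only at this
      linarith
  have e3 : ∀ m n, ((U m (n + 1) : ℝ) - U m n + W m n - W (m + 1) n) * ψ m n =
      ((U m (n + 1) : ℝ) - U m n) * ψ m n + ((W m n : ℝ) - W (m + 1) n) * ψ m n := fun m n => by
    ring
  simp only [e3, Finset.sum_add_distrib]
  rw [Finset.sum_comm (f := fun m n => ((W m n : ℝ) - W (m + 1) n) * ψ m n)]
  have h2 : ∑ n ∈ Finset.range K, ∑ m ∈ Finset.range M, ((W m n : ℝ) - W (m + 1) n) * ψ m n ≤ 0 :=
    Finset.sum_nonpos fun n hn => (e2 n (Finset.mem_range.1 hn) M).trans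
      (neg_nonpos.2 (mul_nonneg (Nat.cast_nonneg _) (h0 _ _)))
  have h3 : ∑ m ∈ Finset.range M, ∑ n ∈ Finset.range K, ((U m (n + 1) : ℝ) - U m n) * ψ m n ≤
      ∑ m ∈ Finset.range M, (U m K : ℝ) :=
    Finset.sum_le_sum fun m hmM => (e1 m (Finset.mem_range.1 hmM) K).trans
      (mul_le_of_le_one_right (Nat.cast_nonneg _) (h1 m))
  linarith

/-- The bound that the certificate gives for every table with the properties of the cell means. -/
theorem sum_totalGain_sub_le {ψ : ℕ → ℕ → ℝ} (h0 : ∀ m n, 0 ≤ ψ m n)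
    (h1 : ∀ m n, 16 ≤ n → ψ m n = 1) (h2 : ∀ m n, 16 ≤ m → n < 16 → ψ m n = 0)
    (hm : ∀ m, Monotone (ψ m)) (ha : ∀ n, Antitone fun m => ψ m n) :
    (∑ n ∈ Finset.range 16, ∑ m ∈ Finset.range 18, totalGain m n * ψ m n) -
      ∑ m ∈ Finset.range 16, ∑ n ∈ Finset.range 18, totalLoss m n * ψ m n ≤ 138 - 381072 := by
  have key := sum_flow_le rankMultiplier timeMultiplier (M := 16) (K := 16) h0
    (fun m => (h1 m 16 le_rfl).le) hm ha rankMultiplier_zero timeMultiplier_zero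
  have hr : ∑ m ∈ Finset.range 16, (rankMultiplier m 16 : ℝ) = 138 := by
    exact_mod_cast sum_rankMultiplier
  have hl : ∑ m ∈ Finset.range 16, ((totalLoss m 16 : ℝ) + totalLoss m 17) = 381072 := by
    exact_mod_cast sum_totalLoss
  -- Gains at time `1` are worth nothing.
  have e1 : ∑ n ∈ Finset.range 16, ∑ m ∈ Finset.range 18, totalGain m n * ψ m n =
      ∑ m ∈ Finset.range 16, ∑ n ∈ Finset.range 16, totalGain m n * ψ m n := by
    rw [Finset.sum_comm, Finset.sum_range_succ, Finset.sum_range_succ]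
    have : ∀ m, 16 ≤ m → ∑ n ∈ Finset.range 16, totalGain m n * ψ m n = 0 := fun m hm =>
      Finset.sum_eq_zero fun n hn => by rw [h2 m n hm (Finset.mem_range.1 hn), mul_zero]
    rw [this 16 le_rfl, this 17 (by norm_num), add_zero, add_zero]
  -- Losses at rank `1`, where `α = 1` and the price is `1`, contribute a constant.
  have e2 : ∑ m ∈ Finset.range 16, ∑ n ∈ Finset.range 18, totalLoss m n * ψ m n =
      (∑ m ∈ Finset.range 16, ∑ n ∈ Finset.range 16, totalLoss m n * ψ m n) + 381072 := by
    rw [← hl, ← Finset.sum_add_distrib]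
    refine Finset.sum_congr rfl fun m _ => ?_
    rw [Finset.sum_range_succ, Finset.sum_range_succ, h1 m 16 le_rfl, h1 m 17 (by norm_num)]
    ring
  have e3 : ∑ m ∈ Finset.range 16, ∑ n ∈ Finset.range 16, ((rankMultiplier m (n + 1) : ℝ) -
      rankMultiplier m n + timeMultiplier m n - timeMultiplier (m + 1) n) * ψ m n =
      (∑ m ∈ Finset.range 16, ∑ n ∈ Finset.range 16, totalGain m n * ψ m n) -
      ∑ m ∈ Finset.range 16, ∑ n ∈ Finset.range 16, totalLoss m n * ψ m n := by
    simp only [← Finset.sum_sub_distrib]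
    refine Finset.sum_congr rfl fun m hm => Finset.sum_congr rfl fun n hn => ?_
    have := congrArg (Nat.cast (R := ℝ))
      (totalGain_add_eq m (Finset.mem_range.1 hm) n (Finset.mem_range.1 hn))
    push_cast at this
    linear_combination (-ψ m n) * this
  rw [e1, e2]
  linarith

/-! ### The upper bound -/

section

variable {f : I → I → I} (hf : IsPricing f)

/-- The averaged horizontal part of `Gam` for a strategy, times `256`. -/
noncomputable def strategyLoss (f : I → I → I) (s : ℕ × List ℕ × List ℕ) : ℝ :=
  ∑ m ∈ Finset.range 16, ∑ n ∈ Finset.range 18,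
    cellWeight 8 (levels s.2.1) (levels s.2.2) n m * cellMean 8 f m n

/-- The averaged vertical part of `Gam` for a strategy, times `256`. -/
noncomputable def strategyGain (f : I → I → I) (s : ℕ × List ℕ × List ℕ) : ℝ :=
  ∑ n ∈ Finset.range 16, ∑ m ∈ Finset.range 18,
    cellWeight 8 (countUpTo 8 (levels s.2.2)) (countUpTo 8 (levels s.2.1)) m n * cellMean 8 f m n

include hf

theorem IsValid.mem_SUnweighted {s : ℕ × List ℕ × List ℕ} (hs : IsValid s) (q : I × I) :
    ((fun x => level 8 q.2 (levels s.2.1 (cellJumps 8 q.1 x))),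
      (fun x => level 8 q.2 (levels s.2.2 (cellJumps 8 q.1 x)))) ∈ SUnweighted f := by
  obtain ⟨⟨hl1, hl2⟩, h, h0, -⟩ := hs
  refine step_mem_SUnweighted hf.monotone_rank 8 (cellPoint_mono 8 q.1)
    (A := fun p => level 8 q.2 (levels s.2.1 p)) (B := fun p => level 8 q.2 (levels s.2.2 p))
    ((level_mono 8 q.2).comp (levels_mono hl1 fun p hp => (h p hp).1))
    ((level_mono 8 q.2).comp (levels_mono hl2 fun p hp => (h p hp).2.1)) ?_ fun p => ?_
  · rw [h0, level_zero]
  · refine level_mono 8 q.2 ?_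
    rcases lt_or_ge p 9 with hp | hp
    · exact (h p hp).2.2
    · rw [levels_of_le hl1 hp, levels_of_le hl2 hp]

/-- The bound holds for every choice of offsets, hence for the mean over them; `256 = 4 * 8 ^ 2` is
the normalisation of the cell means. -/
theorem IsValid.le_of_le_Gam {c : ℝ} (hc : ∀ p ∈ SUnweighted f, c ≤ Gam f p.1 p.2)
    {s : ℕ × List ℕ × List ℕ} (hs : IsValid s) :
    c ≤ 1 - strategyLoss f s / 256 + strategyGain f s / 256 := by
  have hmem := hs.mem_SUnweighted hf
  obtain ⟨⟨hl1, hl2⟩, h, h0, h1⟩ := hs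
  have ha := levels_mono hl1 fun p hp => (h p hp).1
  have hb := levels_mono hl2 fun p hp => (h p hp).2.1
  have ha9 : ∀ p, levels s.2.1 p ≤ 9 := fun p =>
    (ha (Nat.le_add_right p 9)).trans_eq (levels_of_le hl1 (by omega))
  obtain ⟨hi, he⟩ := integral_Gam_step (N := 8) (by norm_num) hf.measurable ha hb
    (fun p => h1.trans (ha (Nat.zero_le p))) h0
  have hle := integral_mono (integrable_const c) hi fun q => hc _ (hmem q)
  rw [he, sum_gapWeight_mul (levels s.2.2) ha9 fun m n => cellMean 8 f n m,
    sum_gapWeight_mul _ (countUpTo_le 8 _) (cellMean 8 f)] at hle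
  have h256 : (4 * ((8 : ℕ) : ℝ) ^ 2) = 256 := by norm_num
  have hconst : ∫ _ : I × I, c = c := by simp
  rw [h256, hconst] at hle
  exact hle

theorem sum_strategyGain_sub_le :
    (strategies.map fun s => (s.1 : ℝ) * strategyGain f s).sum -
      (strategies.map fun s => (s.1 : ℝ) * strategyLoss f s).sum ≤ 138 - 381072 := by
  have hc := sum_totalGain_sub_le (ψ := cellMean 8 f) cellMean_nonneg
    (fun m n hn => hf.cellMean_eq_one (by norm_num) m hn)
    (fun m n hm hn => hf.cellMean_eq_zero (by norm_num) hm hn) hf.cellMean_mono hf.cellMean_antitone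
  unfold totalGain totalLoss at hc
  unfold strategyGain strategyLoss
  generalize strategies = L at *
  rw [sum_map_mul_sum L (fun s m n => cellWeight 8 (levels s.2.1) (levels s.2.2) m n) 16 18
    fun m n => cellMean 8 f n m, sum_map_mul_sum L (fun s m n =>
    cellWeight 8 (countUpTo 8 (levels s.2.2)) (countUpTo 8 (levels s.2.1)) m n)]
  exact hc

theorem iInf_Gam_le : ⨅ p ∈ SUnweighted f, (Gam f p.1 p.2 : EReal) ≤ ((0.7027 : ℝ) : EReal) := by
  by_contra hlt
  rw [not_le] at hlt
  have hGam : ∀ p ∈ SUnweighted f, 0.7027 ≤ Gam f p.1 p.2 := fun p hp =>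
    (EReal.coe_lt_coe_iff.1 (hlt.trans_le (iInf₂_le p hp))).le
  have hc := sum_strategyGain_sub_le hf
  have hw := sum_weights
  have hv := isValid_of_mem_strategies
  generalize strategies = L at *
  have hsum : ((L.map fun s => s.1).sum : ℕ) * (0.7027 : ℝ) ≤ ((L.map fun s => s.1).sum : ℕ) -
      (L.map fun s => (s.1 : ℝ) * strategyLoss f s).sum / 256 +
      (L.map fun s => (s.1 : ℝ) * strategyGain f s).sum / 256 := by
    clear hc hw
    induction L with
    | nil => simp
    | cons s L ih =>
      have h1 := ih fun t ht => hv t (List.mem_cons_of_mem _ ht)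
      have h2 := mul_le_mul_of_nonneg_left ((hv s List.mem_cons_self).le_of_le_Gam hf hGam)
        (Nat.cast_nonneg (α := ℝ) s.1)
      simp only [List.map_cons, List.sum_cons, Nat.cast_add]
      linarith
  rw [hw] at hsum
  push_cast at hsum
  -- The contradiction is `5002 + (138 - 381072) / 256 < 0.7027 * 5002`.
  linarith

end

theorem optValueUnweighted_le : optValueUnweighted ≤ ((0.7027 : ℝ) : EReal) :=
  iSup₂_le fun _ hf => iInf_Gam_le hf

theorem optValue_le_optValueUnweighted : optValue ≤ optValueUnweighted :=
  iSup₂_mono fun _ _ => biInf_mono fun _ ⟨l, r, G, u, v, x, y, _, h⟩ => ⟨l, r, G, u, v, x, y, h⟩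

end Ranking

theorem theorem3p1 :
    (((0.6862 : ℝ) : EReal) ≤ Ranking.optValue ∧ Ranking.optValue ≤ ((0.7027 : ℝ) : EReal)) ∧
      Ranking.optValueUnweighted ≤ ((0.7027 : ℝ) : EReal) :=
  ⟨⟨Ranking.le_optValue, Ranking.optValue_le_optValueUnweighted.trans Ranking.optValueUnweighted_le⟩,
    Ranking.optValueUnweighted_le⟩
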